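/- Let $d,b,m\ge 1$ be integers, $N=b^m$, and $0<q<1$. Let $H:[0,1]\to[0,1]^d$ be a Hilbert space filling curve, i.e. a continuous map such that for every $k\ge 0$ it maps the $2^{dk}$ successive intervals $[\kappa 2^{-dk},(\kappa+1)2^{-dk}]$ onto the $2^{dk}$ closed dyadic subcubes of $[0,1]^d$ of side $2^{-k}$, each subcube being taken exactly once and successive intervals being mapped onto subcubes with a common $(d-1)$-dimensional face. Let $X_1,\dots,X_N$ be Hilbert space filling curve (HSFC) samples: $X_i=H(x_i)$ with $x_1,\dots,x_N$ independent and $x_i$ uniformly distributed on $[\frac{i-1}{N},\frac iN]$. For $t_1,\dots,t_N\in[0,1]^d$ let $$D_N^*(t_1,\dots,t_N)=\sup_{x\in[0,1]^d}\Big|\lambda([0,x])-\frac1N\sum_{n=1}^N \mathbf 1_{[0,x]}(t_n)\Big|$$ be the star discrepancy, and put $$B_{d,N}(q)=\frac{6d^{3/4}}{N^{\frac12+\frac1{2d}}}\sqrt{d\ln(N+1)+c(d,q)}+\frac{2c(d,q)}{3N},\qquad c(d,q)=\ln\frac{(2e)^d}{\sqrt{2\pi d}\,(1-q)}.$$ Let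 $f$ be a real function of class $C^d$ on $[0,1]^d$ (for instance a smooth one), let $\Omega$ be a Borel convex subset of $[0,1]^d$ (so that $f\cdot\mathbf 1_\Omega$ is piecewise smooth), and let $$V(f)=\sum_{u\subseteq\{1,\dots,d\}}2^{d-|u|}\int_{[0,1]^d}\Big|\frac{\partial^{|u|}f}{\partial x_u}(x)\Big|\,dx,$$ where $\partial^{|u|}f/\partial x_u$ is the mixed partial derivative of $f$, once in each of the coordinates with index in $u$. Then with probability at least $q$ both $$D_N^*(X_1,\dots,X_N)\le B_{d,N}(q)\qquad\text{and}\qquad \Big|\frac1N\sum_{n=1}^N (f\cdot\mathbf 1_\Omega)(X_n)-\int_\Omega f(x)\,dx\Big|\le 2^d\,B_{d,N}(q)\,V(f)$$ hold. -/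

import Mathlib

open MeasureTheory ProbabilityTheory Set
open scoped ContDiff

noncomputable section

/-- The closed dyadic subcube of `[0,1]^d` of side `2^{-k}` with lower corner `c / 2^k`. -/
def dyadicCube {d : ℕ} (k : ℕ) (c : Fin d → Fin (2 ^ k)) : Set (Fin d → ℝ) :=
  {x | ∀ j, x j ∈ Icc (((c j : ℕ) : ℝ) / 2 ^ k) ((((c j : ℕ) : ℝ) + 1) / 2 ^ k)}

/-- Two grid cells are neighbours when they share a `(d-1)`-dimensional face: their integer
coordinates agree in all directions but one, where they differ by exactly `1`. -/
def FaceAdjacent {d n : ℕ} (c c' : Fin d → Fin n) : Prop :=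
  ∃ j, ((c j : ℕ) + 1 = (c' j : ℕ) ∨ (c' j : ℕ) + 1 = (c j : ℕ)) ∧ ∀ i, i ≠ j → c i = c' i

/-- `H` (of which only the restriction to `[0,1]` matters) is a `d`-dimensional Hilbert space
filling curve: it is continuous on `[0,1]` and, for every level `k`, it maps the `2^{dk}`
successive intervals of length `2^{-dk}` onto the `2^{dk}` dyadic subcubes of side `2^{-k}` of
`[0,1]^d`, each subcube being taken exactly once, and successive intervals being mapped onto
subcubes with a common face. (The nesting of the subcubes of successive levels is automatic,
since they are images of nested intervals.) For `d ≥ 2` such curves are not unique. -/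
structure IsHilbertCurve (d : ℕ) (H : ℝ → Fin d → ℝ) : Prop where
  continuousOn : ContinuousOn H (Icc 0 1)
  exists_order : ∀ k : ℕ, ∃ c : Fin (2 ^ (d * k)) ≃ (Fin d → Fin (2 ^ k)),
    (∀ κ : Fin (2 ^ (d * k)), H '' Icc (((κ : ℕ) : ℝ) / 2 ^ (d * k)) ((((κ : ℕ) : ℝ) + 1) / 2 ^ (d * k)) =
      dyadicCube k (c κ)) ∧
    ∀ κ κ' : Fin (2 ^ (d * k)), (κ : ℕ) + 1 = (κ' : ℕ) → FaceAdjacent (c κ) (c κ')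

/-- `X_1, …, X_N` are Hilbert space filling curve samples: `X_i = H(x_i)`, where `x_1, …, x_N` are
independent and `x_i` is uniformly distributed on `I_i = [(i-1)/N, i/N]` (indices are shifted by
one, so that they start at `0`). -/
def IsHSFCSample {S : Type*} [MeasurableSpace S] {d N : ℕ} (P : Measure S) (H : ℝ → Fin d → ℝ)
    (X : Fin N → S → Fin d → ℝ) : Prop :=
  ∃ x : Fin N → S → ℝ, iIndepFun x P ∧
    (∀ i, pdf.IsUniform (x i) (Icc (((i : ℕ) : ℝ) / N) ((((i : ℕ) : ℝ) + 1) / N)) P volume) ∧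
    ∀ i s, X i s = H (x i s)

open Classical in
/-- The star discrepancy
`sup_{x ∈ [0,1]^d} |λ([0,x]) - #{n : t_n ∈ [0,x]} / N|` of the points `t_1, …, t_N`. -/
def starDiscrepancy {d N : ℕ} (t : Fin N → Fin d → ℝ) : ℝ :=
  ⨆ x : Icc (0 : Fin d → ℝ) 1,
    |volume.real (Icc 0 (x : Fin d → ℝ)) -
      ((Finset.univ.filter fun n => t n ∈ Icc 0 (x : Fin d → ℝ)).card : ℝ) / N|

/-- The constant `c(d,q) = ln ((2e)^d / (√(2πd) (1-q)))`. -/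
def hsfcConst (d : ℕ) (q : ℝ) : ℝ :=
  Real.log ((2 * Real.exp 1) ^ d / (Real.sqrt (2 * Real.pi * d) * (1 - q)))

/-- The probabilistic star discrepancy bound
`6 d^{3/4} N^{-1/2-1/(2d)} √(d ln(N+1) + c(d,q)) + 2 c(d,q) / (3N)`. -/
def hsfcBound (d N : ℕ) (q : ℝ) : ℝ :=
  6 * (d : ℝ) ^ (3 / 4 : ℝ) / (N : ℝ) ^ (1 / 2 + 1 / (2 * (d : ℝ))) *
      Real.sqrt (d * Real.log (N + 1) + hsfcConst d q) +
    2 * hsfcConst d q / (3 * N)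

/-- The mixed partial derivative `∂^{|u|} f / ∂x_u` on the closed unit cube: `f` is differentiated
once in each of the coordinates with index in `u`. -/
def mixedPartial {d : ℕ} (u : Finset (Fin d)) (f : (Fin d → ℝ) → ℝ) (x : Fin d → ℝ) : ℝ :=
  iteratedFDerivWithin ℝ u.card f (Icc 0 1) x
    fun k => Pi.single (u.orderEmbOfFin rfl k) (1 : ℝ)

/-- `V(f) = ∑_{u ⊆ {1,…,d}} 2^{d-|u|} ∫_{[0,1]^d} |∂^{|u|} f / ∂x_u|`. -/
def cubeVariation {d : ℕ} (f : (Fin d → ℝ) → ℝ) : ℝ :=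
  ∑ u : Finset (Fin d), (2 : ℝ) ^ (d - u.card) * ∫ x in Icc (0 : Fin d → ℝ) 1, |mixedPartial u f x|

end

/-! For a fixed convex set `A` in the cube, the number of samples in `A` is a sum of independent 0/1
variables, one for each interval of length `1/N`. A Hilbert curve transports Lebesgue measure, so
the mean is `N λ(A)`. A variable can be random only if the image of its open interval meets the
frontier of `interior A`: otherwise connectedness keeps the image on one side, and the frontier of
`A` itself is null. Thus Hoeffding's inequality applies with the number of boundary intervals in
place of `N`.

The geometric core is that there are at most `32 d^{3/2} N^{1-1/d}` boundary intervals
(`IsHilbertCurve.card_inter_frontier_le`). It follows from a bound of `8 d^{3/2} n^{d-1}` on the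
cells of a grid of mesh `1/n`, `n = 2^k`, that meet a convex boundary
(`card_dyadicCube_inter_frontier_le`). A supporting normal `v` at a boundary point limits how many
boundary cells follow in each coordinate direction: at most `‖v‖₁ / |v_j|` in direction `j`.
Charging every cell to the `d` grid lines through it, with weight `i^{-3/2}` for rank `i` on the
line, gives each cell a total of at least `d^{-1/2}`, while each line pays out at most 8.

A union bound over boxes with corners in a grid of mesh `1/N` makes the counting error uniform over
`K ∩ [0,y]` (`IsHSFCSample.measureReal_exists_boxError_le`). This is used for `K` the whole cube,
which gives the discrepancy, and for the given convex set. The quadrature bound is then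
deterministic: a Koksma–Hlawka inequality compares two measures through their values on boxes
(`abs_integral_sub_integral_le`). The indicator is put into the measures, so only the variation of
the smooth factor enters. -/

/-! ### Combinatorics: charging cells to grid lines. -/

/-- The summable weight `1, 1, 2^{-3/2}, 3^{-3/2}, …` used to charge boundary cells to grid
lines. -/
noncomputable def lineWeight (i : ℕ) : ℝ := if i = 0 then 1 else 1 / Real.sqrt i ^ 3

theorem lineWeight_nonneg (i : ℕ) : 0 ≤ lineWeight i := by
  unfold lineWeight
  split_ifs <;> positivity

/-- Telescoping: `b^{-3} ≤ 2/a - 2/b` for `a = √(m+1)`, `b = √(m+2)`. The induction starts from the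
two initial terms, where it is an equality. -/
theorem sum_lineWeight_le (n : ℕ) : ∑ i ∈ Finset.range n, lineWeight i ≤ 4 := by
  have key : ∀ m : ℕ, ∑ i ∈ Finset.range (m + 2), lineWeight i ≤ 4 - 2 / Real.sqrt (m + 1) := by
    intro m
    induction m with
    | zero => simp [Finset.sum_range_succ, lineWeight]; norm_num
    | succ m ih =>
      rw [Finset.sum_range_succ]
      have hw : lineWeight (m + 2) = 1 / Real.sqrt (m + 2) ^ 3 := by
        unfold lineWeight
        rw [if_neg (by omega)]
        push_cast
        rfl
      have ha : 0 < Real.sqrt ((m : ℝ) + 1) := Real.sqrt_pos.2 (by positivity)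
      have hb : 0 < Real.sqrt ((m : ℝ) + 2) := Real.sqrt_pos.2 (by positivity)
      have ha2 : Real.sqrt ((m : ℝ) + 1) ^ 2 = m + 1 := Real.sq_sqrt (by positivity)
      have hb2 : Real.sqrt ((m : ℝ) + 2) ^ 2 = m + 2 := Real.sq_sqrt (by positivity)
      have hab : Real.sqrt ((m : ℝ) + 1) ≤ Real.sqrt ((m : ℝ) + 2) :=
        Real.sqrt_le_sqrt (by linarith)
      have hcast : (((m + 1 : ℕ) : ℝ) + 1) = m + 2 := by push_cast; ring
      rw [hcast, show m + 1 + 1 = m + 2 from rfl, hw]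
      set a := Real.sqrt ((m : ℝ) + 1)
      set b := Real.sqrt ((m : ℝ) + 2)
      have h1 : 1 / b ^ 3 ≤ 2 / a - 2 / b := by
        have hdiff : (b - a) * (a + b) = 1 := by nlinarith
        rw [div_sub_div _ _ ha.ne' hb.ne', div_le_div_iff₀ (by positivity) (by positivity)]
        have h2 : a * b ≤ b * b := by nlinarith
        have h3 : 1 ≤ 2 * b * (b - a) := by nlinarith
        nlinarith [mul_pos hb hb, mul_pos (mul_pos hb hb) hb]
      linarith
  have h := key n
  have hmono : ∑ i ∈ Finset.range n, lineWeight i ≤ ∑ i ∈ Finset.range (n + 2), lineWeight i :=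
    Finset.sum_le_sum_of_subset_of_nonneg
      (Finset.range_subset_range.2 (by omega)) fun i _ _ => lineWeight_nonneg i
  have : 0 ≤ 2 / Real.sqrt ((n : ℝ) + 1) := by positivity
  linarith

/-- If the rank `ρ` takes pairwise distinct values, then the total weight of the ranks is at
most `4`. -/
theorem sum_lineWeight_comp_le {ι : Type*} (s : Finset ι) (ρ : ι → ℕ)
    (hρ : Set.InjOn ρ s) : ∑ m ∈ s, lineWeight (ρ m) ≤ 4 := by
  classical
  rw [← Finset.sum_image (f := lineWeight) hρ]
  refine le_trans (Finset.sum_le_sum_of_subset_of_nonneg (t := Finset.range ((s.image ρ).sup id + 1))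
    ?_ fun i _ _ => lineWeight_nonneg i) (sum_lineWeight_le _)
  intro i hi
  have : id i ≤ (s.image ρ).sup id := Finset.le_sup hi
  simp only [id] at this
  exact Finset.mem_range.2 (by omega)

/-- Ranks counted from the top of a line are distinct, so the weights are distinct terms of the
convergent series. The mirror version counts from the bottom. -/
theorem sum_lineWeight_rank_lt_le {n : ℕ} (s : Finset (Fin n)) :
    ∑ m ∈ s, lineWeight (s.filter fun m' => m < m').card ≤ 4 := by
  refine sum_lineWeight_comp_le s _ ?_
  have key : ∀ a ∈ s, ∀ b ∈ s, a < b →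
      (s.filter fun m' => b < m').card < (s.filter fun m' => a < m').card := by
    intro a _ b hb hab
    apply Finset.card_lt_card
    rw [Finset.ssubset_iff_of_subset]
    · exact ⟨b, by simp [hb, hab], by simp⟩
    · intro c hc
      simp only [Finset.mem_filter] at hc ⊢
      exact ⟨hc.1, hab.trans hc.2⟩
  intro a ha b hb hab
  rcases lt_trichotomy a b with h | h | h
  · exact absurd hab (key a ha b hb h).ne'
  · exact h
  · exact absurd hab (key b hb a ha h).ne

theorem sum_lineWeight_rank_gt_le {n : ℕ} (s : Finset (Fin n)) :
    ∑ m ∈ s, lineWeight (s.filter fun m' => m' < m).card ≤ 4 := by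
  refine sum_lineWeight_comp_le s _ ?_
  have key : ∀ a ∈ s, ∀ b ∈ s, a < b →
      (s.filter fun m' => m' < a).card < (s.filter fun m' => m' < b).card := by
    intro a ha b _ hab
    apply Finset.card_lt_card
    rw [Finset.ssubset_iff_of_subset]
    · exact ⟨a, by simp [ha, hab], by simp⟩
    · intro c hc
      simp only [Finset.mem_filter] at hc ⊢
      exact ⟨hc.1, hc.2.trans hab⟩
  intro a ha b hb hab
  rcases lt_trichotomy a b with h | h | h
  · exact absurd hab (key a ha b hb h).ne
  · exact h
  · exact absurd hab (key b hb a ha h).ne'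

/-- Summation over a grid, line by line in direction `j`. -/
theorem sum_sum_update_eq {d n : ℕ} (j : Fin d) (g : (Fin d → Fin n) → ℝ) :
    ∑ c : Fin d → Fin n, ∑ m : Fin n, g (Function.update c j m) = n * ∑ c, g c := by
  classical
  -- Exchanging `m` with the coordinate `c j` turns the double sum into one whose summand no longer
  -- depends on `m`.
  have hinv : Function.Involutive
      (fun p : (Fin d → Fin n) × Fin n => (Function.update p.1 j p.2, p.1 j)) := by
    intro p
    simp
  have h := Equiv.sum_comp hinv.toPerm (fun p : (Fin d → Fin n) × Fin n => g p.1)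
  rw [← Fintype.sum_prod_type'
    (f := fun (c : Fin d → Fin n) (m : Fin n) => g (Function.update c j m))]
  refine h.trans ?_
  rw [Fintype.sum_prod_type]
  simp [Finset.mul_sum]

/-- The tangent line inequality for `x ↦ x^{3/2}`, summed over a probability vector. -/
theorem one_div_sqrt_le_sum_mul_sqrt {d : ℕ} (hd : 0 < d) (r : Fin d → ℝ) (hr : ∀ j, 0 ≤ r j)
    (hsum : ∑ j, r j = 1) : 1 / Real.sqrt d ≤ ∑ j, Real.sqrt (r j) ^ 3 := by
  have hd' : (0 : ℝ) < d := by exact_mod_cast hd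
  set t := 1 / Real.sqrt (d : ℝ) with ht
  have hs : 0 < Real.sqrt (d : ℝ) := Real.sqrt_pos.2 hd'
  have ht0 : 0 < t := by positivity
  have ht2 : (d : ℝ) * t ^ 2 = 1 := by
    rw [ht, div_pow, Real.sq_sqrt hd'.le]
    field_simp
  have h1 : ∀ j, 3 / 2 * t * r j - 1 / 2 * t ^ 3 ≤ Real.sqrt (r j) ^ 3 := by
    intro j
    have h2 := Real.sq_sqrt (hr j)
    have h3 := Real.sqrt_nonneg (r j)
    set s := Real.sqrt (r j)
    rw [← h2]
    nlinarith [mul_nonneg (sq_nonneg (s - t)) (by positivity : 0 ≤ s + t / 2)]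
  have h2 := Finset.sum_le_sum fun j (_ : j ∈ Finset.univ) => h1 j
  rw [Finset.sum_sub_distrib, ← Finset.mul_sum, hsum] at h2
  simp only [Finset.sum_const, Finset.card_univ, Fintype.card_fin, nsmul_eq_mul] at h2
  have h3 : (d : ℝ) * (1 / 2 * t ^ 3) = 1 / 2 * t := by
    calc (d : ℝ) * (1 / 2 * t ^ 3) = 1 / 2 * t * (d * t ^ 2) := by ring
      _ = _ := by rw [ht2, mul_one]
  linarith

/-- This converts a rank bound `i ≤ 1/r` into a charge: `r^{3/2} ≤ i^{-3/2}`, with `r ≤ 1` covering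
rank zero. -/
theorem sqrt_pow_three_le_lineWeight {r : ℝ} (hr : 0 ≤ r) (hr1 : r ≤ 1) {i : ℕ} (hi : i * r ≤ 1) :
    Real.sqrt r ^ 3 ≤ lineWeight i := by
  unfold lineWeight
  split_ifs with h
  · have : Real.sqrt r ≤ 1 := Real.sqrt_le_one.2 hr1
    exact pow_le_one₀ (Real.sqrt_nonneg _) this
  · have hi0 : (0 : ℝ) < i := by exact_mod_cast Nat.pos_of_ne_zero h
    rw [le_div_iff₀ (by positivity), ← mul_pow, ← Real.sqrt_mul hr]
    exact pow_le_one₀ (Real.sqrt_nonneg _) (Real.sqrt_le_one.2 (by linarith))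

/-- A finite set `S` of grid cells such that along every grid line, and for each cell `c`, the
number of cells beyond `c` is controlled by a probability vector `r`, is small. -/
theorem card_le_of_rank_bound {d n : ℕ} (hd : 0 < d) (S : Finset (Fin d → Fin n))
    (hS : ∀ c ∈ S, ∃ r : Fin d → ℝ, (∀ j, 0 ≤ r j) ∧ ∑ j, r j = 1 ∧ ∀ j,
      ((Finset.univ.filter fun m => Function.update c j m ∈ S ∧ c j < m).card : ℝ) * r j ≤ 1 ∨
      ((Finset.univ.filter fun m => Function.update c j m ∈ S ∧ m < c j).card : ℝ) * r j ≤ 1) :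
    (S.card : ℝ) * n ≤ 8 * (d * Real.sqrt d) * n ^ d := by
  classical
  have hd' : (0 : ℝ) < d := by exact_mod_cast hd
  have hs : 0 < Real.sqrt (d : ℝ) := Real.sqrt_pos.2 hd'
  let up : Fin d → (Fin d → Fin n) → ℕ := fun j c =>
    (Finset.univ.filter fun m => Function.update c j m ∈ S ∧ c j < m).card
  let dn : Fin d → (Fin d → Fin n) → ℕ := fun j c =>
    (Finset.univ.filter fun m => Function.update c j m ∈ S ∧ m < c j).card
  -- Only one of the two orientations is controlled in each direction; adding both weights makes the
  -- charge independent of which one.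
  have h1 : ∀ c ∈ S, 1 / Real.sqrt d ≤ ∑ j, (lineWeight (up j c) + lineWeight (dn j c)) := by
    intro c hc
    obtain ⟨r, hr0, hr1, hr⟩ := hS c hc
    refine (one_div_sqrt_le_sum_mul_sqrt hd r hr0 hr1).trans (Finset.sum_le_sum fun j _ => ?_)
    have hrj : r j ≤ 1 := hr1 ▸ Finset.single_le_sum (fun i _ => hr0 i) (Finset.mem_univ j)
    rcases hr j with h | h
    · have := sqrt_pow_three_le_lineWeight (hr0 j) hrj h
      have := lineWeight_nonneg (dn j c)
      linarith
    · have := sqrt_pow_three_le_lineWeight (hr0 j) hrj h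
      have := lineWeight_nonneg (up j c)
      linarith
  -- A line pays at most 4 for each orientation. Summing over all `n^d` base cells counts each line
  -- `n` times.
  have h2 : ∀ j, (n : ℝ) * ∑ c : Fin d → Fin n,
      (if c ∈ S then lineWeight (up j c) + lineWeight (dn j c) else 0) ≤ n ^ d * 8 := by
    intro j
    rw [← sum_sum_update_eq j]
    have h3 : ∀ c : Fin d → Fin n, (∑ m : Fin n, if Function.update c j m ∈ S then
        lineWeight (up j (Function.update c j m)) + lineWeight (dn j (Function.update c j m))
        else 0) ≤ 8 := by
      intro c
      rw [← Finset.sum_filter, Finset.sum_add_distrib]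
      have ha := sum_lineWeight_rank_lt_le (Finset.univ.filter fun m => Function.update c j m ∈ S)
      have hb := sum_lineWeight_rank_gt_le (Finset.univ.filter fun m => Function.update c j m ∈ S)
      simp only [Finset.filter_filter] at ha hb
      simp only [up, dn, Function.update_idem, Function.update_self]
      linarith
    refine (Finset.sum_le_sum fun c _ => h3 c).trans (le_of_eq ?_)
    simp
  have h4 : (S.card : ℝ) * (1 / Real.sqrt d) ≤
      ∑ j, ∑ c : Fin d → Fin n,
        (if c ∈ S then lineWeight (up j c) + lineWeight (dn j c) else 0) := by
    rw [Finset.sum_comm, ← nsmul_eq_mul, ← Finset.sum_const]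
    have : ∀ c : Fin d → Fin n, (∑ j, if c ∈ S then lineWeight (up j c) + lineWeight (dn j c)
        else 0) = if c ∈ S then ∑ j, (lineWeight (up j c) + lineWeight (dn j c)) else 0 := by
      intro c
      split_ifs <;> simp
    simp only [this]
    rw [← Finset.sum_filter, Finset.filter_mem_eq_inter, Finset.univ_inter]
    exact Finset.sum_le_sum h1
  have h5 : (n : ℝ) * (S.card * (1 / Real.sqrt d)) ≤ d * (n ^ d * 8) := by
    refine (mul_le_mul_of_nonneg_left h4 (Nat.cast_nonneg n)).trans ?_
    rw [Finset.mul_sum]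
    refine (Finset.sum_le_sum fun j _ => h2 j).trans (le_of_eq ?_)
    simp
  have h6 : (S.card : ℝ) * n = (n * (S.card * (1 / Real.sqrt d))) * Real.sqrt d := by
    field_simp
  rw [h6]
  calc _ ≤ (d * (n ^ d * 8)) * Real.sqrt d := mul_le_mul_of_nonneg_right h5 hs.le
    _ = _ := by ring

/-! ### Convex boundaries in a dyadic grid. -/

/-- Supporting hyperplane of an open convex set at a boundary point, in coordinates. -/
theorem exists_supporting_vector {d : ℕ} {A : Set (Fin d → ℝ)} (hA : Convex ℝ A) (hAo : IsOpen A)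
    {p : Fin d → ℝ} (hp : p ∈ frontier A) :
    ∃ v : Fin d → ℝ, v ≠ 0 ∧ ∀ a ∈ closure A, ∑ j, v j * (a j - p j) ≤ 0 := by
  rw [hAo.frontier_eq] at hp
  obtain ⟨f, hf⟩ := geometric_hahn_banach_open_point hA hAo hp.2
  have hrep : ∀ x : Fin d → ℝ, f x = ∑ j, f (Pi.single j 1) * x j := by
    intro x
    have := LinearMap.pi_apply_eq_sum_univ (f : (Fin d → ℝ) →ₗ[ℝ] ℝ) x
    simp only [ContinuousLinearMap.coe_coe, smul_eq_mul] at this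
    rw [this]
    refine Finset.sum_congr rfl fun j _ => ?_
    rw [mul_comm]
    congr 2
    ext i
    simp [Pi.single_apply, eq_comm]
  refine ⟨fun j => f (Pi.single j 1), ?_, ?_⟩
  · intro h0
    obtain ⟨a, ha⟩ : A.Nonempty := closure_nonempty_iff.1 ⟨p, hp.1⟩
    have h1 := hf a ha
    have h2 : ∀ j, f (Pi.single j 1) = 0 := fun j => congrFun h0 j
    rw [hrep a, hrep p] at h1
    simp [h2] at h1
  · intro a ha
    have h1 : f a ≤ f p := by
      refine closure_minimal (s := A) (t := {x | f x ≤ f p}) (fun x hx => (hf x hx).le) ?_ ha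
      exact isClosed_le f.continuous continuous_const
    have h2 : ∑ j, f (Pi.single j 1) * (a j - p j) = f a - f p := by
      rw [hrep a, hrep p, ← Finset.sum_sub_distrib]
      exact Finset.sum_congr rfl fun j _ => by ring
    rw [h2]
    linarith

/-- The frontier of an open convex set meets at most `8 d^{3/2} n^{d-1}` cells of the grid of mesh
`1/n`, for `n = 2^k`. -/
theorem card_dyadicCube_inter_frontier_le {d : ℕ} (hd : 0 < d) (k : ℕ) {A : Set (Fin d → ℝ)}
    (hA : Convex ℝ A) (hAo : IsOpen A) (S : Finset (Fin d → Fin (2 ^ k)))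
    (hS : ∀ c, c ∈ S ↔ (dyadicCube k c ∩ frontier A).Nonempty) :
    (S.card : ℝ) * 2 ^ k ≤ 8 * (d * Real.sqrt d) * (2 ^ k) ^ d := by
  have h := card_le_of_rank_bound hd S ?_
  · exact_mod_cast h
  intro c hc
  obtain ⟨p, hpc, hp⟩ := (hS c).1 hc
  obtain ⟨v, hv0, hv⟩ := exists_supporting_vector hA hAo hp
  have hn : (0 : ℝ) < 2 ^ k := by positivity
  have hV : 0 < ∑ j, |v j| := by
    obtain ⟨j, hj⟩ := Function.ne_iff.1 hv0
    exact Finset.sum_pos' (fun i _ => abs_nonneg _) ⟨j, Finset.mem_univ j, abs_pos.2 hj⟩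
  set V := ∑ j, |v j|
  -- moving `m - c j` cells along direction `j` on the side of `v j`
  have hmove : ∀ j (m : Fin (2 ^ k)), Function.update c j m ∈ S →
      v j * ((m : ℝ) - (c j : ℕ)) ≤ V := by
    intro j m hm
    obtain ⟨a, hac, ha⟩ := (hS _).1 hm
    have h1 := hv a (frontier_subset_closure ha)
    have h2 : ∀ i, v i * ((if i = j then (m : ℝ) - (c j : ℕ) else 0)) - |v i| ≤
        v i * (2 ^ k * (a i - p i)) := by
      intro i
      have ha1 := hac i
      have hp1 := hpc i
      rw [mem_Icc, div_le_iff₀ hn, le_div_iff₀ hn] at ha1 hp1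
      -- In mesh units, points of two cells differ by the shift of the cells up to 1 per coordinate.
      -- Paired with `v`, these errors cost at most `V` in total.
      have hdev : |2 ^ k * (a i - p i) - (if i = j then (m : ℝ) - (c j : ℕ) else 0)| ≤ 1 := by
        rw [abs_le]
        by_cases hij : i = j
        · subst hij
          simp only [Function.update_self] at ha1
          simp only [if_true]
          constructor <;> linarith [ha1.1, ha1.2, hp1.1, hp1.2]
        · rw [Function.update_of_ne hij] at ha1
          simp only [if_neg hij]
          constructor <;> linarith [ha1.1, ha1.2, hp1.1, hp1.2]
      have h3 := abs_mul (v i)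
        (2 ^ k * (a i - p i) - (if i = j then (m : ℝ) - (c j : ℕ) else 0))
      have h4 := neg_abs_le (v i *
        (2 ^ k * (a i - p i) - (if i = j then (m : ℝ) - (c j : ℕ) else 0)))
      have h5 := mul_le_mul_of_nonneg_left hdev (abs_nonneg (v i))
      have h6 := mul_sub (v i) (2 ^ k * (a i - p i)) (if i = j then (m : ℝ) - (c j : ℕ) else 0)
      linarith
    have h3 := Finset.sum_le_sum fun i (_ : i ∈ Finset.univ) => h2 i
    have h4 : ∑ i, v i * (2 ^ k * (a i - p i)) ≤ 0 := by
      have : ∑ i, v i * (2 ^ k * (a i - p i)) = 2 ^ k * ∑ i, v i * (a i - p i) := by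
        rw [Finset.mul_sum]
        exact Finset.sum_congr rfl fun i _ => by ring
      rw [this]
      exact mul_nonpos_of_nonneg_of_nonpos hn.le h1
    rw [Finset.sum_sub_distrib] at h3
    simp only [mul_ite, mul_zero, Finset.sum_ite_eq', Finset.mem_univ, if_true] at h3
    linarith
  -- The probability vector is the normalised normal. In direction `j` the cells counted lie on the
  -- side towards which `v j` points.
  refine ⟨fun j => |v j| / V, fun j => by positivity, ?_, ?_⟩
  · rw [← Finset.sum_div]
    exact div_self hV.ne'
  · intro j
    rcases le_total 0 (v j) with hj | hj
    · left
      rw [← mul_div_assoc, div_le_one hV, abs_of_nonneg hj]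
      rcases (Finset.univ.filter fun m => Function.update c j m ∈ S ∧ c j < m).eq_empty_or_nonempty
        with he | hne
      · rw [he]; simpa using hV.le
      · have hmem := Finset.max'_mem _ hne
        -- The count is at most the distance to the farthest boundary cell of the line, and `hmove`
        -- bounds that distance.
        set M := Finset.max' _ hne
        have hcard : (Finset.univ.filter fun m => Function.update c j m ∈ S ∧ c j < m).card ≤
            (M : ℕ) - c j := by
          rw [← Fin.card_Ioc]
          refine Finset.card_le_card fun m hm => ?_
          exact Finset.mem_Ioc.2 ⟨(Finset.mem_filter.1 hm).2.2, Finset.le_max' _ m hm⟩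
        have hM := (Finset.mem_filter.1 hmem).2
        have hlt : (c j : ℕ) ≤ (M : ℕ) := hM.2.le
        have hcard' : ((Finset.univ.filter fun m => Function.update c j m ∈ S ∧ c j < m).card : ℝ) ≤
            (M : ℕ) - (c j : ℕ) := by
          rw [← Nat.cast_sub hlt]
          exact_mod_cast hcard
        have := mul_le_mul_of_nonneg_right hcard' hj
        have := hmove j M hM.1
        linarith
    · right
      rw [← mul_div_assoc, div_le_one hV, abs_of_nonpos hj]
      rcases (Finset.univ.filter fun m => Function.update c j m ∈ S ∧ m < c j).eq_empty_or_nonempty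
        with he | hne
      · rw [he]; simpa using hV.le
      · have hmem := Finset.min'_mem _ hne
        set M := Finset.min' _ hne
        have hcard : (Finset.univ.filter fun m => Function.update c j m ∈ S ∧ m < c j).card ≤
            (c j : ℕ) - M := by
          rw [← Fin.card_Ico]
          refine Finset.card_le_card fun m hm => ?_
          exact Finset.mem_Ico.2 ⟨Finset.min'_le _ m hm, (Finset.mem_filter.1 hm).2.2⟩
        have hM := (Finset.mem_filter.1 hmem).2
        have hlt : (M : ℕ) ≤ (c j : ℕ) := hM.2.le
        have hcard' : ((Finset.univ.filter fun m => Function.update c j m ∈ S ∧ m < c j).card : ℝ) ≤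
            (c j : ℕ) - (M : ℕ) := by
          rw [← Nat.cast_sub hlt]
          exact_mod_cast hcard
        have := mul_le_mul_of_nonneg_right hcard' (neg_nonneg.2 hj)
        have := hmove j M hM.1
        linarith

/-! ### Transport of Lebesgue measure by a Hilbert curve. -/

theorem setIntegral_unitInterval_eq_sum {N : ℕ} (hN : 0 < N) {g : ℝ → ℝ}
    (hg : IntegrableOn g (Icc 0 1)) :
    ∫ t in Icc (0 : ℝ) 1, g t =
      ∑ i : Fin N, ∫ t in Icc (((i : ℕ) : ℝ) / N) ((((i : ℕ) : ℝ) + 1) / N), g t := by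
  have hN' : (0 : ℝ) < N := by exact_mod_cast hN
  have hle : ∀ i : ℕ, (i : ℝ) / N ≤ ((i + 1 : ℕ) : ℝ) / N := fun i => by
    push_cast
    gcongr
    linarith
  have h := intervalIntegral.sum_integral_adjacent_intervals (f := g) (μ := volume)
    (a := fun i : ℕ => (i : ℝ) / N) (n := N) ?_
  · rw [integral_Icc_eq_integral_Ioc, ← intervalIntegral.integral_of_le zero_le_one,
      ← Fin.sum_univ_eq_sum_range
        (fun i => ∫ x in ((i : ℝ) / N)..(((i + 1 : ℕ) : ℝ) / N), g x) N] at *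
    rw [Nat.cast_zero, zero_div, div_self hN'.ne'] at h
    rw [← h]
    refine Finset.sum_congr rfl fun i _ => ?_
    rw [intervalIntegral.integral_of_le (hle i), integral_Icc_eq_integral_Ioc]
    push_cast
    rfl
  · intro i hi
    rw [intervalIntegrable_iff_integrableOn_Icc_of_le (hle i)]
    refine hg.mono_set (Icc_subset_Icc (by positivity) ?_)
    rw [div_le_one hN']
    exact_mod_cast hi

theorem dyadicCube_eq_Icc {d k : ℕ} (c : Fin d → Fin (2 ^ k)) :
    dyadicCube k c = Icc (fun j => ((c j : ℕ) : ℝ) / 2 ^ k)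
      (fun j => (((c j : ℕ) : ℝ) + 1) / 2 ^ k) := by
  ext x
  simp only [dyadicCube, mem_ofPred_eq, mem_Icc, Pi.le_def]
  exact ⟨fun h => ⟨fun j => (h j).1, fun j => (h j).2⟩, fun h j => ⟨h.1 j, h.2 j⟩⟩

theorem measurableSet_dyadicCube {d k : ℕ} (c : Fin d → Fin (2 ^ k)) :
    MeasurableSet (dyadicCube k c) := by
  rw [dyadicCube_eq_Icc]
  exact measurableSet_Icc

theorem volume_real_dyadicCube {d k : ℕ} (c : Fin d → Fin (2 ^ k)) :
    volume.real (dyadicCube k c) = 1 / 2 ^ (d * k) := by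
  rw [dyadicCube_eq_Icc, measureReal_def, Real.volume_Icc_pi_toReal]
  · have : ∀ j, (((c j : ℕ) : ℝ) + 1) / 2 ^ k - ((c j : ℕ) : ℝ) / 2 ^ k = 1 / 2 ^ k := fun j => by
      rw [← sub_div]; ring
    simp only [this, Finset.prod_const, Finset.card_univ, Fintype.card_fin]
    rw [div_pow, one_pow, ← pow_mul, mul_comm k d]
  · intro j
    show _ / _ ≤ _ / _
    gcongr
    linarith

theorem exists_fin_mem_Icc_div {N : ℕ} (hN : 0 < N) {y : ℝ} (hy : y ∈ Icc (0 : ℝ) 1) :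
    ∃ e : Fin N, y ∈ Icc (((e : ℕ) : ℝ) / N) ((((e : ℕ) : ℝ) + 1) / N) := by
  have hN' : (0 : ℝ) < N := by exact_mod_cast hN
  rcases hy.2.eq_or_lt with h1 | h1
  -- The endpoint 1 goes to the last interval, since the floor used below would give the index `N`,
  -- out of range.
  · refine ⟨⟨N - 1, Nat.sub_lt hN one_pos⟩, ?_⟩
    have hcast : ((N - 1 : ℕ) : ℝ) = N - 1 := by rw [Nat.cast_sub hN, Nat.cast_one]
    simp only [hcast, sub_add_cancel, mem_Icc]
    rw [h1, div_self hN'.ne', div_le_one hN']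
    exact ⟨by linarith, le_rfl⟩
  · refine ⟨⟨⌊y * N⌋₊, ?_⟩, ?_⟩
    · rw [Nat.floor_lt (mul_nonneg hy.1 hN'.le)]
      nlinarith
    · rw [mem_Icc, div_le_iff₀ hN', le_div_iff₀ hN']
      exact ⟨Nat.floor_le (mul_nonneg hy.1 hN'.le), (Nat.lt_floor_add_one _).le⟩

theorem iUnion_dyadicCube (d k : ℕ) :
    ⋃ c : Fin d → Fin (2 ^ k), dyadicCube k c = Icc 0 1 := by
  have hn : (0 : ℝ) < 2 ^ k := by positivity
  ext x
  simp only [mem_iUnion, dyadicCube, mem_ofPred_eq]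
  constructor
  · rintro ⟨c, hc⟩
    refine ⟨fun j => (by positivity : (0 : ℝ) ≤ _).trans (hc j).1, fun j => (hc j).2.trans ?_⟩
    rw [Pi.one_apply, div_le_one hn]
    exact_mod_cast (c j).2
  · intro hx
    have hex : ∀ j, ∃ m : Fin (2 ^ k), x j ∈ Icc (((m : ℕ) : ℝ) / 2 ^ k)
        ((((m : ℕ) : ℝ) + 1) / 2 ^ k) := fun j => by
      exact_mod_cast exists_fin_mem_Icc_div (Nat.two_pow_pos k) (⟨hx.1 j, hx.2 j⟩ : x j ∈ Icc 0 1)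
    choose c hc using hex
    exact ⟨c, hc⟩

theorem aedisjoint_dyadicCube {d k : ℕ} :
    Pairwise (Function.onFun (AEDisjoint (volume : Measure (Fin d → ℝ)))
      fun c : Fin d → Fin (2 ^ k) => dyadicCube k c) := by
  have hn : (0 : ℝ) < 2 ^ k := by positivity
  have key : ∀ (c c' : Fin d → Fin (2 ^ k)) (j : Fin d), (c j : ℕ) < (c' j : ℕ) →
      (volume : Measure (Fin d → ℝ)) (dyadicCube k c ∩ dyadicCube k c') = 0 := by
    intro c c' j hj
    refine measure_mono_null (t := {x : Fin d → ℝ | x j = ((c' j : ℕ) : ℝ) / 2 ^ k}) ?_ ?_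
    · rintro x ⟨h1, h2⟩
      refine le_antisymm ((h1 j).2.trans ?_) (h2 j).1
      gcongr
      exact_mod_cast hj
    · rw [volume_pi]
      exact Measure.pi_hyperplane _ j _
  intro c c' hcc
  obtain ⟨j, hj⟩ := Function.ne_iff.1 hcc
  rcases lt_or_gt_of_ne (fun h => hj (Fin.ext h) : (c j : ℕ) ≠ c' j) with h | h
  · exact key c c' j h
  · show volume _ = 0
    rw [inter_comm]
    exact key c' c j h

theorem setIntegral_unitCube_eq_sum {d : ℕ} (k : ℕ) {g : (Fin d → ℝ) → ℝ}
    (hg : IntegrableOn g (Icc 0 1)) :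
    ∫ x in Icc (0 : Fin d → ℝ) 1, g x =
      ∑ c : Fin d → Fin (2 ^ k), ∫ x in dyadicCube k c, g x := by
  rw [← iUnion_dyadicCube d k] at hg ⊢
  rw [integral_iUnion_ae (fun c => (measurableSet_dyadicCube c).nullMeasurableSet)
    aedisjoint_dyadicCube hg, tsum_fintype]

/-- A curve on `[0,1]`, extended to the line by constants. -/
noncomputable def clampedCurve {d : ℕ} (H : ℝ → Fin d → ℝ) (t : ℝ) : Fin d → ℝ :=
  H (projIcc 0 1 zero_le_one t)

theorem clampedCurve_of_mem {d : ℕ} (H : ℝ → Fin d → ℝ) {t : ℝ} (ht : t ∈ Icc (0 : ℝ) 1) :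
    clampedCurve H t = H t := by
  rw [clampedCurve, projIcc_of_mem zero_le_one ht]

theorem IsHilbertCurve.continuous_clampedCurve {d : ℕ} {H : ℝ → Fin d → ℝ}
    (hH : IsHilbertCurve d H) : Continuous (clampedCurve H) :=
  hH.continuousOn.comp_continuous (continuous_subtype_val.comp continuous_projIcc)
    fun t => (projIcc 0 1 zero_le_one t).2

theorem abs_setIntegral_sub_le {α : Type*} [MeasurableSpace α] {μ : Measure α} {s : Set α}
    (hsf : μ s < ⊤) {g : α → ℝ} (hg : IntegrableOn g s μ) {a ε : ℝ}
    (h : ∀ x ∈ s, |g x - a| ≤ ε) : |(∫ x in s, g x ∂μ) - μ.real s * a| ≤ ε * μ.real s := by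
  have h1 : (∫ x in s, g x ∂μ) - μ.real s * a = ∫ x in s, (g x - a) ∂μ := by
    rw [integral_sub hg (integrableOn_const hsf.ne)]
    simp
  rw [h1, ← Real.norm_eq_abs]
  exact norm_setIntegral_le_of_norm_le_const hsf h

/-- A Hilbert curve transports Lebesgue measure on `[0,1]` to Lebesgue measure on the cube. -/
theorem IsHilbertCurve.map_volume {d : ℕ} {H : ℝ → Fin d → ℝ} (hH : IsHilbertCurve d H) :
    (volume.restrict (Icc (0 : ℝ) 1)).map (clampedCurve H) =
      volume.restrict (Icc (0 : Fin d → ℝ) 1) := by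
  have hc := hH.continuous_clampedCurve
  have : IsFiniteMeasure (volume.restrict (Icc (0 : Fin d → ℝ) 1)) :=
    ⟨by rw [Measure.restrict_apply_univ]; exact isCompact_Icc.measure_lt_top⟩
  refine ext_of_forall_integral_eq_of_IsFiniteMeasure fun g => ?_
  rw [integral_map hc.measurable.aemeasurable g.continuous.aestronglyMeasurable]
  have hgc : IntegrableOn (fun x => g x) (Icc (0 : Fin d → ℝ) 1) :=
    g.continuous.continuousOn.integrableOn_compact isCompact_Icc
  have hgH : IntegrableOn (fun t => g (clampedCurve H t)) (Icc (0 : ℝ) 1) :=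
    (g.continuous.comp hc).continuousOn.integrableOn_compact isCompact_Icc
  refine eq_of_forall_dist_le fun ε hε => ?_
  rw [Real.dist_eq]
  -- uniform continuity gives a mesh at which both integrals are close cell by cell
  have huc := isCompact_Icc.uniformContinuousOn_of_continuous
    (g.continuous.continuousOn (s := Icc (0 : Fin d → ℝ) 1))
  obtain ⟨δ, hδ, hδg⟩ := Metric.uniformContinuousOn_iff.1 huc (ε / 2) (by positivity)
  obtain ⟨k, hk⟩ := exists_pow_lt_of_lt_one hδ (by norm_num : (1 / 2 : ℝ) < 1)
  obtain ⟨c, hcI, -⟩ := hH.exists_order k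
  have hn : (0 : ℝ) < 2 ^ k := by positivity
  have hcell : ∀ e : Fin d → Fin (2 ^ k), ∀ x ∈ dyadicCube k e, ∀ y ∈ dyadicCube k e,
      |g x - g y| ≤ ε / 2 := by
    intro e x hx y hy
    have hsub : dyadicCube k e ⊆ Icc 0 1 := by
      rw [← iUnion_dyadicCube d k]
      exact subset_iUnion (fun c => dyadicCube k c) e
    refine (hδg x (hsub hx) y (hsub hy) ?_).le
    refine lt_of_le_of_lt ((dist_pi_le_iff (by positivity)).2 fun j => ?_) hk
    rw [Real.dist_eq, abs_le, div_pow, one_pow]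
    have h1 := hx j
    have h2 := hy j
    rw [mem_Icc, add_div] at h1 h2
    constructor <;> linarith [h1.1, h1.2, h2.1, h2.2]
  have hNpos : 0 < 2 ^ (d * k) := by positivity
  rw [setIntegral_unitInterval_eq_sum hNpos hgH, setIntegral_unitCube_eq_sum k hgc,
    ← Equiv.sum_comp c, ← Finset.sum_sub_distrib]
  have hterm : ∀ κ : Fin (2 ^ (d * k)),
      |(∫ t in Icc (((κ : ℕ) : ℝ) / (2 ^ (d * k) : ℕ)) ((((κ : ℕ) : ℝ) + 1) / (2 ^ (d * k) : ℕ)),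
        g (clampedCurve H t)) - ∫ x in dyadicCube k (c κ), g x| ≤ ε * (1 / 2 ^ (d * k)) := by
    intro κ
    push_cast
    set I := Icc (((κ : ℕ) : ℝ) / 2 ^ (d * k)) ((((κ : ℕ) : ℝ) + 1) / 2 ^ (d * k)) with hI
    have hIsub : I ⊆ Icc 0 1 := by
      refine Icc_subset_Icc (by positivity) ?_
      rw [div_le_one (by positivity)]
      exact_mod_cast κ.2
    have hle : ((κ : ℕ) : ℝ) / 2 ^ (d * k) ≤ (((κ : ℕ) : ℝ) + 1) / 2 ^ (d * k) := by
      gcongr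
      linarith
    have hmaps : ∀ t ∈ I, clampedCurve H t ∈ dyadicCube k (c κ) := fun t ht => by
      rw [clampedCurve_of_mem H (hIsub ht), ← hcI κ]
      exact mem_image_of_mem H ht
    have hvolI : volume.real I = 1 / 2 ^ (d * k) := by
      rw [hI, Real.volume_real_Icc_of_le hle, ← sub_div]
      ring
    have hvolQ := volume_real_dyadicCube (c κ)
    set z := clampedCurve H (((κ : ℕ) : ℝ) / 2 ^ (d * k))
    have hz : z ∈ dyadicCube k (c κ) := hmaps _ (left_mem_Icc.2 hle)
    have h1 := abs_setIntegral_sub_le (μ := volume) (s := I)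
      isCompact_Icc.measure_lt_top (hgH.mono_set hIsub)
      (a := g z) (ε := ε / 2) fun t ht => hcell _ _ (hmaps t ht) _ hz
    have hsubQ : dyadicCube k (c κ) ⊆ Icc 0 1 := by
      rw [← iUnion_dyadicCube d k]
      exact subset_iUnion (fun c => dyadicCube k c) _
    have h2 := abs_setIntegral_sub_le (μ := volume) (s := dyadicCube k (c κ))
      ((measure_mono hsubQ).trans_lt isCompact_Icc.measure_lt_top) (hgc.mono_set hsubQ)
      (a := g z) (ε := ε / 2) fun x hx => hcell _ _ hx _ hz
    rw [hvolI] at h1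
    rw [hvolQ] at h2
    rw [abs_le] at h1 h2 ⊢
    constructor <;> linarith [h1.1, h1.2, h2.1, h2.2]
  refine (Finset.abs_sum_le_sum_abs _ _).trans ((Finset.sum_le_sum fun κ _ => hterm κ).trans ?_)
  rw [Finset.sum_const, Finset.card_univ, Fintype.card_fin, nsmul_eq_mul]
  push_cast
  refine le_of_eq ?_
  field_simp

/-! ### Sampling intervals that meet a convex boundary. -/

theorem card_le_of_forall_mem_Ioo {N : ℕ} (T : Finset (Fin N)) {a b : ℝ} (ha : 0 ≤ a) (hab : a ≤ b)
    (hT : ∀ i ∈ T, a < ((i : ℕ) : ℝ) + 1 ∧ ((i : ℕ) : ℝ) < b) : (T.card : ℝ) ≤ b - a + 2 := by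
  have h1 : T.card ≤ ⌈b⌉₊ - ⌊a⌋₊ := by
    rw [← Nat.card_Ico, ← Finset.card_map Fin.valEmbedding]
    refine Finset.card_le_card fun m hm => ?_
    obtain ⟨i, hi, rfl⟩ := Finset.mem_map.1 hm
    rw [Finset.mem_Ico]
    refine ⟨?_, Nat.lt_ceil.2 (hT i hi).2⟩
    have : ⌊a⌋₊ < (i : ℕ) + 1 := (Nat.floor_lt ha).2 (by push_cast; exact (hT i hi).1)
    exact Nat.lt_succ_iff.1 this
  have h2 : ((⌈b⌉₊ - ⌊a⌋₊ : ℕ) : ℝ) ≤ b - a + 2 := by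
    rcases le_total ⌊a⌋₊ ⌈b⌉₊ with h | h
    · rw [Nat.cast_sub h]
      linarith [Nat.ceil_lt_add_one (ha.trans hab), Nat.lt_floor_add_one a]
    · rw [Nat.sub_eq_zero_of_le h, Nat.cast_zero]
      linarith
  exact (Nat.cast_le.2 h1).trans h2

/-- The number of intervals `(i/N, (i+1)/N)` whose image under a Hilbert curve meets the frontier
of an open convex set is at most `32 d^{3/2} N^{1-1/d}`. -/
theorem IsHilbertCurve.card_inter_frontier_le {d : ℕ} (hd : 0 < d) {H : ℝ → Fin d → ℝ}
    (hH : IsHilbertCurve d H) {N : ℕ} (hN : 0 < N) {A : Set (Fin d → ℝ)} (hA : Convex ℝ A)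
    (hAo : IsOpen A) (J : Finset (Fin N))
    (hJ : ∀ i ∈ J, ∃ t ∈ Ioo (((i : ℕ) : ℝ) / N) ((((i : ℕ) : ℝ) + 1) / N),
      H t ∈ frontier A) :
    (J.card : ℝ) ≤ 32 * (d * Real.sqrt d) * (N / (N : ℝ) ^ (1 / (d : ℝ))) := by
  classical
  have hN' : (0 : ℝ) < N := by exact_mod_cast hN
  have hd' : (0 : ℝ) < d := by exact_mod_cast hd
  have hbase : 1 < 2 ^ d := Nat.one_lt_two_pow hd.ne'
  -- The level is chosen so that `2^k ≤ N^{1/d} ≤ 2 · 2^k`: dyadic intervals and sampling intervals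
  -- then have comparable length.
  set k := Nat.log (2 ^ d) N with hk
  set ρ : ℝ := (N : ℝ) ^ (1 / (d : ℝ)) with hρ
  have hρ0 : 0 < ρ := Real.rpow_pos_of_pos hN' _
  have hρd : ρ ^ d = N := by
    rw [hρ, ← Real.rpow_natCast, ← Real.rpow_mul hN'.le, one_div, inv_mul_cancel₀ hd'.ne',
      Real.rpow_one]
  have hn : (0 : ℝ) < 2 ^ k := by positivity
  have hnρ : (2 : ℝ) ^ k ≤ ρ := by
    refine le_of_pow_le_pow_left₀ hd.ne' hρ0.le ?_
    rw [hρd, ← pow_mul, mul_comm, pow_mul]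
    exact_mod_cast Nat.pow_log_le_self (2 ^ d) hN.ne'
  have hρn : ρ ≤ 2 * 2 ^ k := by
    refine le_of_pow_le_pow_left₀ hd.ne' (by positivity) ?_
    rw [hρd, ← pow_succ', ← pow_mul, mul_comm, pow_mul]
    exact_mod_cast (Nat.lt_pow_succ_log_self hbase N).le
  obtain ⟨c, hc, -⟩ := hH.exists_order k
  let S : Finset (Fin d → Fin (2 ^ k)) :=
    Finset.univ.filter fun e => (dyadicCube k e ∩ frontier A).Nonempty
  have hS := card_dyadicCube_inter_frontier_le hd k hA hAo S (by simp [S])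
  have hM : (0 : ℝ) < 2 ^ (d * k) := by positivity
  let T : (Fin d → Fin (2 ^ k)) → Finset (Fin N) := fun e => Finset.univ.filter fun i =>
    ((c.symm e : ℕ) : ℝ) / 2 ^ (d * k) * N < ((i : ℕ) : ℝ) + 1 ∧
      ((i : ℕ) : ℝ) < (((c.symm e : ℕ) : ℝ) + 1) / 2 ^ (d * k) * N
  have hTcard : ∀ e, ((T e).card : ℝ) ≤ N / 2 ^ (d * k) + 2 := by
    intro e
    refine (card_le_of_forall_mem_Ioo (T e) (by positivity) ?_
      fun i hi => (Finset.mem_filter.1 hi).2).trans (le_of_eq ?_)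
    · gcongr
      linarith
    · ring
  have hsub : J ⊆ S.biUnion T := by
    intro i hi
    obtain ⟨t, ht, htA⟩ := hJ i hi
    have ht01 : t ∈ Icc (0 : ℝ) 1 := by
      refine ⟨(by positivity : (0 : ℝ) ≤ _).trans ht.1.le, ht.2.le.trans ?_⟩
      rw [div_le_one hN']
      exact_mod_cast i.2
    obtain ⟨κ, hκ⟩ : ∃ κ : Fin (2 ^ (d * k)),
        t ∈ Icc (((κ : ℕ) : ℝ) / 2 ^ (d * k)) ((((κ : ℕ) : ℝ) + 1) / 2 ^ (d * k)) := by
      exact_mod_cast exists_fin_mem_Icc_div (Nat.two_pow_pos (d * k)) ht01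
    refine Finset.mem_biUnion.2 ⟨c κ, ?_, ?_⟩
    · refine Finset.mem_filter.2 ⟨Finset.mem_univ _, H t, ?_, htA⟩
      rw [← hc κ]
      exact mem_image_of_mem H hκ
    · refine Finset.mem_filter.2 ⟨Finset.mem_univ _, ?_⟩
      rw [Equiv.symm_apply_apply, ← lt_div_iff₀ hN', ← div_lt_iff₀ hN']
      exact ⟨hκ.1.trans_lt ht.2, ht.1.trans_le hκ.2⟩
  have h1 : (J.card : ℝ) ≤ S.card * (N / 2 ^ (d * k) + 2) := by
    have h2 : J.card ≤ ∑ e ∈ S, (T e).card :=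
      (Finset.card_le_card hsub).trans Finset.card_biUnion_le
    have h3 : (J.card : ℝ) ≤ ∑ e ∈ S, ((T e).card : ℝ) := by exact_mod_cast h2
    refine h3.trans ((Finset.sum_le_sum fun e _ => hTcard e).trans (le_of_eq ?_))
    rw [Finset.sum_const, nsmul_eq_mul]
  have hpow : ((2 : ℝ) ^ k) ^ d = 2 ^ (d * k) := by rw [← pow_mul, mul_comm]
  have hS' : (S.card : ℝ) ≤ 8 * (d * Real.sqrt d) * (2 ^ (d * k) / 2 ^ k) := by
    rw [← hpow, ← mul_div_assoc, le_div_iff₀ hn]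
    exact hS
  have h2 : (2 : ℝ) ^ (d * k) / 2 ^ k ≤ N / ρ := by
    obtain ⟨e, rfl⟩ : ∃ e, d = e + 1 := ⟨d - 1, by omega⟩
    rw [← hpow, ← hρd, pow_succ, pow_succ, mul_div_assoc, mul_div_assoc, div_self hn.ne',
      div_self hρ0.ne', mul_one, mul_one]
    exact pow_le_pow_left₀ hn.le hnρ e
  have h3 : (N : ℝ) / 2 ^ k ≤ 2 * (N / ρ) := by
    rw [← mul_div_assoc, div_le_div_iff₀ hn hρ0]
    nlinarith
  -- Each boundary cell accounts for at most `N / 2^{dk} + 2` sampling intervals; the constant is `8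
  -- · (2 + 2)`.
  calc (J.card : ℝ) ≤ S.card * (N / 2 ^ (d * k) + 2) := h1
    _ ≤ 8 * (d * Real.sqrt d) * (2 ^ (d * k) / 2 ^ k) * (N / 2 ^ (d * k) + 2) := by gcongr
    _ = 8 * (d * Real.sqrt d) * (N / 2 ^ k + 2 * (2 ^ (d * k) / 2 ^ k)) := by
      field_simp
    _ ≤ 8 * (d * Real.sqrt d) * (2 * (N / ρ) + 2 * (N / ρ)) := by gcongr
    _ = _ := by ring

/-! ### Concentration for one convex set. -/

/-- Hoeffding's inequality for independent `[0,1]`-valued variables, at most `R` of which are not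
almost surely constant. -/
theorem measureReal_abs_sum_sub_ge_le {S ι : Type*} [MeasurableSpace S] [Fintype ι] {P : Measure S}
    [IsProbabilityMeasure P] {Y : ι → S → ℝ} (hY : iIndepFun Y P) (hm : ∀ i, AEMeasurable (Y i) P)
    (h01 : ∀ i s, Y i s ∈ Icc (0 : ℝ) 1) (J : Finset ι)
    (hJ : ∀ i ∉ J, ∃ a : ℝ, ∀ᵐ s ∂P, Y i s = a) {R : ℝ} (hR : 0 < R) (hJR : (J.card : ℝ) ≤ R)
    {ε : ℝ} (hε : 0 ≤ ε) :
    P.real {s | ε ≤ |∑ i, Y i s - ∑ i, ∫ s, Y i s ∂P|} ≤ 2 * Real.exp (-(2 * ε ^ 2 / R)) := by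
  classical
  let Z : ι → S → ℝ := fun i s => Y i s - ∫ s, Y i s ∂P
  have hZ : iIndepFun Z P :=
    hY.comp (fun i y => y - ∫ s, Y i s ∂P) fun i => measurable_id.sub_const _
  -- Hoeffding's lemma gives the variance proxy `(1 - 0)^2 / 4`; an almost surely constant variable
  -- contributes nothing.
  let c : ι → NNReal := fun i => if i ∈ J then 1 / 4 else 0
  have hsub : ∀ i ∈ Finset.univ, HasSubgaussianMGF (Z i) (c i) P := by
    intro i _
    by_cases hi : i ∈ J
    · have h := hasSubgaussianMGF_of_mem_Icc (a := 0) (b := 1) (hm i) (ae_of_all _ (h01 i))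
      convert h using 1
      simp only [c, if_pos hi]
      simp
      norm_num
    · obtain ⟨a, ha⟩ := hJ i hi
      have hint : ∫ s, Y i s ∂P = a := by
        rw [integral_congr_ae ha]
        simp
      simp only [c, if_neg hi]
      refine HasSubgaussianMGF.fun_zero.congr ?_
      filter_upwards [ha] with s hs
      simp [Z, hs, hint]
  have hsum := HasSubgaussianMGF.sum_of_iIndepFun hZ hsub
  have hcsum : ((∑ i, c i : NNReal) : ℝ) = J.card / 4 := by
    simp only [c, Finset.sum_ite_mem, Finset.univ_inter, Finset.sum_const]
    push_cast
    ring
  set R' : NNReal := ⟨R / 4, by positivity⟩ with hR'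
  have hle : ((∑ i, c i : NNReal) : ℝ) ≤ R' := by
    rw [hcsum]
    show _ ≤ R / 4
    linarith
  -- Enlarging the proxy to `R / 4 > 0` also covers empty `J`, where the exponent would have
  -- denominator zero.
  have hsum' : HasSubgaussianMGF (fun s => ∑ i, Z i s) R' P :=
    ⟨hsum.integrable_exp_mul, fun t => (hsum.mgf_le t).trans (by gcongr)⟩
  have hval : -ε ^ 2 / (2 * (R' : ℝ)) = -(2 * ε ^ 2 / R) := by
    show -ε ^ 2 / (2 * (R / 4)) = _
    field_simp
    ring
  have h1 := hsum'.measure_ge_le hε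
  have h2 := hsum'.neg.measure_ge_le hε
  rw [hval] at h1 h2
  have hss : {s | ε ≤ |∑ i, Y i s - ∑ i, ∫ s, Y i s ∂P|} ⊆
      {s | ε ≤ ∑ i, Z i s} ∪ {s | ε ≤ (-fun s => ∑ i, Z i s) s} := by
    intro s hs
    simp only [mem_ofPred_eq, ← Finset.sum_sub_distrib] at hs
    rcases le_abs.1 hs with h | h
    · exact Or.inl h
    · exact Or.inr h
  refine (measureReal_mono hss).trans ((measureReal_union_le _ _).trans ?_)
  linarith

theorem uniform_interval_facts {S : Type*} [MeasurableSpace S] {P : Measure S} {N : ℕ} (hN : 0 < N)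
    {x : S → ℝ} {i : ℕ} (hx : pdf.IsUniform x (Icc ((i : ℝ) / N) (((i : ℝ) + 1) / N)) P volume) :
    AEMeasurable x P ∧ (∀ B, MeasurableSet B →
      P.real (x ⁻¹' B) = N * volume.real (Icc ((i : ℝ) / N) (((i : ℝ) + 1) / N) ∩ B)) ∧
    ∀ᵐ s ∂P, x s ∈ Ioo ((i : ℝ) / N) (((i : ℝ) + 1) / N) := by
  have hN' : (0 : ℝ) < N := by exact_mod_cast hN
  have hvol : volume (Icc ((i : ℝ) / N) (((i : ℝ) + 1) / N)) = ENNReal.ofReal (1 / N) := by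
    rw [Real.volume_Icc, ← sub_div]
    ring_nf
  have hne : volume (Icc ((i : ℝ) / N) (((i : ℝ) + 1) / N)) ≠ 0 := by
    rw [hvol, Ne, ENNReal.ofReal_eq_zero, not_le]
    positivity
  have hnt : volume (Icc ((i : ℝ) / N) (((i : ℝ) + 1) / N)) ≠ ⊤ := by
    rw [hvol]
    exact ENNReal.ofReal_ne_top
  refine ⟨hx.aemeasurable hne hnt, fun B hB => ?_, ?_⟩
  · rw [measureReal_def, hx.measure_preimage hne hnt hB, hvol, ENNReal.toReal_div,
      ENNReal.toReal_ofReal (by positivity), measureReal_def, div_div_eq_mul_div, div_one, mul_comm]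
  · rw [ae_iff]
    have h := hx.measure_preimage hne hnt (A := (Ioo ((i : ℝ) / N) (((i : ℝ) + 1) / N))ᶜ)
      measurableSet_Ioo.compl
    refine Eq.trans (b := P (x ⁻¹' (Ioo ((i : ℝ) / N) (((i : ℝ) + 1) / N))ᶜ)) rfl (h.trans ?_)
    rw [← sdiff_eq, ENNReal.div_eq_zero_iff]
    left
    exact ae_le_set.1 Ioo_ae_eq_Icc.symm.le

/-- Concentration of the number of HSFC sample points in a fixed convex set. -/
theorem IsHSFCSample.measureReal_convex_deviation_le {S : Type*} [MeasurableSpace S]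
    {P : Measure S} [IsProbabilityMeasure P] {d N : ℕ} (hd : 0 < d) (hN : 0 < N)
    {H : ℝ → Fin d → ℝ} (hH : IsHilbertCurve d H) {X : Fin N → S → Fin d → ℝ}
    (hX : IsHSFCSample P H X) {A : Set (Fin d → ℝ)} (hAm : MeasurableSet A) (hA : Convex ℝ A)
    (hAs : A ⊆ Icc 0 1) {ε : ℝ} (hε : 0 ≤ ε) :
    P.real {s | ε ≤ |∑ n, A.indicator (fun _ => (1 : ℝ)) (X n s) - N * volume.real A|} ≤
      2 * Real.exp (-(2 * ε ^ 2 / (32 * (d * Real.sqrt d) * (N / (N : ℝ) ^ (1 / (d : ℝ)))))) := by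
  classical
  have hN' : (0 : ℝ) < N := by exact_mod_cast hN
  have hd' : (0 : ℝ) < d := by exact_mod_cast hd
  obtain ⟨x, hind, hunif, hXx⟩ := hX
  have hc := hH.continuous_clampedCurve
  have hfacts := fun i => uniform_interval_facts hN (hunif i)
  have hI01 : ∀ i : Fin N, Icc (((i : ℕ) : ℝ) / N) ((((i : ℕ) : ℝ) + 1) / N) ⊆ Icc 0 1 := by
    intro i
    refine Icc_subset_Icc (by positivity) ?_
    rw [div_le_one hN']
    exact_mod_cast i.2
  let B : Set ℝ := clampedCurve H ⁻¹' A
  have hB : MeasurableSet B := hc.measurable hAm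
  let Y : Fin N → S → ℝ := fun i s => B.indicator (fun _ => (1 : ℝ)) (x i s)
  have hYm : ∀ _ : Fin N, Measurable (B.indicator (fun _ : ℝ => (1 : ℝ))) := fun _ =>
    measurable_const.indicator hB
  have hY : iIndepFun Y P := hind.comp (fun _ => B.indicator fun _ => (1 : ℝ)) hYm
  have hYae : ∀ i, AEMeasurable (Y i) P := fun i => (hYm i).comp_aemeasurable (hfacts i).1
  have hY01 : ∀ i s, Y i s ∈ Icc (0 : ℝ) 1 := fun i s =>
    ⟨indicator_nonneg (fun _ _ => zero_le_one) _, indicator_le_self' (fun _ _ => zero_le_one) _⟩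
  -- The counting bound needs an open set, hence the interior. What `A` has outside its interior
  -- lies in its frontier, which the samples almost surely avoid.
  let J : Finset (Fin N) := Finset.univ.filter fun i =>
    ∃ t ∈ Ioo (((i : ℕ) : ℝ) / N) ((((i : ℕ) : ℝ) + 1) / N), H t ∈ frontier (interior A)
  have hJR := hH.card_inter_frontier_le hd hN hA.interior isOpen_interior J
    fun i hi => (Finset.mem_filter.1 hi).2
  have hfr : ∀ i, ∀ᵐ s ∂P, clampedCurve H (x i s) ∉ frontier A := by
    intro i
    have h1 := (hfacts i).2.1 (clampedCurve H ⁻¹' frontier A)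
      (hc.measurable isClosed_frontier.measurableSet)
    have h2 : volume (Icc (((i : ℕ) : ℝ) / N) ((((i : ℕ) : ℝ) + 1) / N) ∩
        clampedCurve H ⁻¹' frontier A) = 0 := by
      refine measure_mono_null (inter_subset_inter_left _ (hI01 i)) ?_
      rw [inter_comm, ← Measure.restrict_apply (hc.measurable isClosed_frontier.measurableSet),
        ← Measure.map_apply hc.measurable isClosed_frontier.measurableSet, hH.map_volume]
      exact Measure.absolutelyContinuous_of_le Measure.restrict_le_self (hA.addHaar_frontier _)
    rw [measureReal_def (s := Icc _ _ ∩ _), h2, ENNReal.toReal_zero, mul_zero,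
      measureReal_eq_zero_iff] at h1
    rw [ae_iff]
    simp only [not_not]
    exact h1
  have hJ : ∀ i ∉ J, ∃ a : ℝ, ∀ᵐ s ∂P, Y i s = a := by
    intro i hi
    have hno : ∀ t ∈ Ioo (((i : ℕ) : ℝ) / N) ((((i : ℕ) : ℝ) + 1) / N),
        clampedCurve H t ∉ frontier (interior A) := by
      intro t ht hfrt
      rw [clampedCurve_of_mem H (hI01 i (Ioo_subset_Icc_self ht))] at hfrt
      exact hi (Finset.mem_filter.2 ⟨Finset.mem_univ _, t, ht, hfrt⟩)
    -- The image is connected and misses the frontier of `interior A`, so it cannot meet both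
    -- `interior A` and the exterior of that set.
    have hconn := isPreconnected_Ioo.image (clampedCurve H) hc.continuousOn
      (s := Ioo (((i : ℕ) : ℝ) / N) ((((i : ℕ) : ℝ) + 1) / N))
    by_cases hall : ∀ t ∈ Ioo (((i : ℕ) : ℝ) / N) ((((i : ℕ) : ℝ) + 1) / N),
        clampedCurve H t ∈ interior A
    · refine ⟨1, ?_⟩
      filter_upwards [(hfacts i).2.2] with s hs
      exact indicator_of_mem (s := B)
        (show x i s ∈ B from interior_subset (s := A) (hall _ hs)) _
    · push Not at hall
      obtain ⟨t, ht, htA⟩ := hall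
      refine ⟨0, ?_⟩
      filter_upwards [(hfacts i).2.2, hfr i] with s hs hs'
      refine indicator_of_notMem (s := B) (fun hmem => ?_) _
      have hint : clampedCurve H (x i s) ∈ interior A := by
        by_contra hni
        exact hs' ⟨subset_closure hmem, hni⟩
      have hcover : clampedCurve H '' Ioo (((i : ℕ) : ℝ) / N) ((((i : ℕ) : ℝ) + 1) / N) ⊆
          interior A ∪ (closure (interior A))ᶜ := by
        rintro _ ⟨u, hu, rfl⟩
        by_contra h
        rw [mem_union, not_or, notMem_compl_iff] at h
        refine hno u hu ?_
        rw [isOpen_interior.frontier_eq]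
        exact ⟨h.2, h.1⟩
      have hout : clampedCurve H t ∈ (closure (interior A))ᶜ := fun h => by
        refine hno t ht ?_
        rw [isOpen_interior.frontier_eq]
        exact ⟨h, htA⟩
      obtain ⟨z, -, hz1, hz2⟩ := hconn (interior A) (closure (interior A))ᶜ isOpen_interior
        isClosed_closure.isOpen_compl hcover ⟨_, mem_image_of_mem _ hs, hint⟩
        ⟨_, mem_image_of_mem _ ht, hout⟩
      exact hz2 (subset_closure hz1)
  have hmean : ∑ i, ∫ s, Y i s ∂P = N * volume.real A := by
    have h1 : ∀ i, ∫ s, Y i s ∂P = N * ∫ t in Icc (((i : ℕ) : ℝ) / N) ((((i : ℕ) : ℝ) + 1) / N),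
        B.indicator (fun _ => (1 : ℝ)) t := by
      intro i
      rw [integral_indicator hB]
      simp only [integral_const, MeasurableSet.univ, measureReal_restrict_apply, univ_inter,
        smul_eq_mul, mul_one]
      rw [measureReal_restrict_apply hB, inter_comm, ← (hfacts i).2.1 B hB]
      have hnull : NullMeasurableSet (x i ⁻¹' B) P := (hfacts i).1.nullMeasurable hB
      have h2 : Y i = (x i ⁻¹' B).indicator (fun _ => (1 : ℝ)) := rfl
      rw [h2, integral_indicator₀ hnull]
      simp
    have hint : IntegrableOn (B.indicator fun _ => (1 : ℝ)) (Icc (0 : ℝ) 1) :=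
      (integrableOn_const isCompact_Icc.measure_lt_top.ne).indicator hB
    rw [Finset.sum_congr rfl fun i _ => h1 i, ← Finset.mul_sum,
      ← setIntegral_unitInterval_eq_sum hN hint, integral_indicator hB]
    congr 1
    simp only [integral_const, smul_eq_mul, mul_one, measureReal_restrict_apply_univ]
    rw [measureReal_def, ← Measure.map_apply hc.measurable hAm, hH.map_volume,
      Measure.restrict_apply hAm, inter_eq_left.2 hAs, measureReal_def]
  have hR : 0 < 32 * (d * Real.sqrt d) * (N / (N : ℝ) ^ (1 / (d : ℝ))) := by
    have := Real.sqrt_pos.2 hd'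
    have := Real.rpow_pos_of_pos hN' (1 / (d : ℝ))
    positivity
  have hmain := measureReal_abs_sum_sub_ge_le hY hYae hY01 J hJ hR hJR hε
  rw [hmean] at hmain
  refine le_trans (le_of_eq (measureReal_congr ?_)) hmain
  have hall : ∀ᵐ s ∂P, ∀ i : Fin N, x i s ∈ Ioo (((i : ℕ) : ℝ) / N) ((((i : ℕ) : ℝ) + 1) / N) :=
    ae_all_iff.2 fun i => (hfacts i).2.2
  filter_upwards [hall] with s hs
  have : ∀ i, A.indicator (fun _ => (1 : ℝ)) (X i s) = Y i s := by
    intro i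
    have h1 : clampedCurve H (x i s) = X i s := by
      rw [clampedCurve_of_mem H (hI01 i (Ioo_subset_Icc_self (hs i))), hXx]
    simp only [Y, B, indicator, mem_preimage, h1]
  show (ε ≤ |_|) = (ε ≤ |_|)
  simp only [this]

/-! ### Uniformity over boxes and the explicit constants. -/

/-- Replacing one factor at a time costs at most `δ`, all other factors being in `[0,1]`. It bounds
the volume between consecutive grid boxes. -/
theorem prod_sub_prod_le_card_mul {ι : Type*} (s : Finset ι) {a b : ι → ℝ} {δ : ℝ}
    (hb : ∀ i, 0 ≤ b i) (hba : ∀ i, b i ≤ a i) (ha : ∀ i, a i ≤ 1) (hδ : ∀ i, a i - b i ≤ δ) :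
    ∏ i ∈ s, a i - ∏ i ∈ s, b i ≤ s.card * δ := by
  classical
  induction s using Finset.induction_on with
  | empty => simp
  | insert i s hi ih =>
    rw [Finset.prod_insert hi, Finset.prod_insert hi, Finset.card_insert_of_notMem hi]
    have h1 : ∏ j ∈ s, a j ≤ 1 :=
      Finset.prod_le_one (fun j _ => (hb j).trans (hba j)) fun j _ => ha j
    have h2 : ∏ j ∈ s, b j ≤ ∏ j ∈ s, a j := Finset.prod_le_prod (fun j _ => hb j) fun j _ => hba j
    have h3 : 0 ≤ ∏ j ∈ s, b j := Finset.prod_nonneg fun j _ => hb j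
    have h4 : b i ≤ 1 := (hba i).trans (ha i)
    have h5 : a i * ∏ j ∈ s, a j - b i * ∏ j ∈ s, b j =
      (a i - b i) * ∏ j ∈ s, a j + b i * (∏ j ∈ s, a j - ∏ j ∈ s, b j) := by ring
    rw [h5]
    push_cast
    have h6 : (a i - b i) * ∏ j ∈ s, a j ≤ a i - b i :=
      mul_le_of_le_one_right (sub_nonneg.2 (hba i)) h1
    have h7 : b i * (∏ j ∈ s, a j - ∏ j ∈ s, b j) ≤ ∏ j ∈ s, a j - ∏ j ∈ s, b j :=
      mul_le_of_le_one_left (sub_nonneg.2 h2) h4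
    linarith [hδ i]

theorem volume_real_box {d : ℕ} {y : Fin d → ℝ} (hy : 0 ≤ y) :
    volume.real (Icc 0 y) = ∏ j, y j := by
  rw [measureReal_def, Real.volume_Icc_pi_toReal hy]
  simp

/-- The counting error of the points `t` in `K ∩ [0,y]`. -/
noncomputable def boxError {d N : ℕ} (K : Set (Fin d → ℝ)) (t : Fin N → Fin d → ℝ)
    (y : Fin d → ℝ) : ℝ :=
  ∑ n, (K ∩ Icc 0 y).indicator (fun _ => (1 : ℝ)) (t n) - N * volume.real (K ∩ Icc 0 y)

/-- If the counting error is small for all boxes with corner in a grid of mesh `1/N`, it is small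
for all boxes. -/
theorem abs_boxError_le_of_grid {d N : ℕ} (hN : 0 < N) {K : Set (Fin d → ℝ)}
    (hK : MeasurableSet K) (t : Fin N → Fin d → ℝ) {ε : ℝ}
    (h : ∀ a : Fin d → Fin (N + 1), |boxError K t fun j => ((a j : ℕ) : ℝ) / N| ≤ ε)
    {y : Fin d → ℝ} (hy : y ∈ Icc (0 : Fin d → ℝ) 1) : |boxError K t y| ≤ ε + d := by
  have hN' : (0 : ℝ) < N := by exact_mod_cast hN
  -- The box is squeezed between grid boxes with corners `L ≤ y ≤ U`. Counts and volumes are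
  -- monotone, so the extra error is at most `N · d/N = d`.
  choose e he using fun j => exists_fin_mem_Icc_div hN (⟨hy.1 j, hy.2 j⟩ : y j ∈ Icc (0 : ℝ) 1)
  set L : Fin d → ℝ := fun j => ((e j : ℕ) : ℝ) / N with hL
  set U : Fin d → ℝ := fun j => (((e j : ℕ) : ℝ) + 1) / N with hU
  have hbL : |boxError K t L| ≤ ε := h fun j => (e j).castSucc
  have hbU : |boxError K t U| ≤ ε := by
    have := h fun j => (e j).succ
    simpa only [Fin.val_succ, Nat.cast_add, Nat.cast_one] using this
  have hL0 : ∀ j, 0 ≤ L j := fun j => by positivity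
  have hLU : ∀ j, L j ≤ U j := fun j => (he j).1.trans (he j).2
  have hU1 : ∀ j, U j ≤ 1 := fun j => by
    show _ / _ ≤ _
    rw [div_le_one hN']
    exact_mod_cast (e j).2
  have hsubL : Icc 0 L ⊆ Icc 0 y := Icc_subset_Icc le_rfl fun j => (he j).1
  have hsubU : Icc 0 y ⊆ Icc 0 U := Icc_subset_Icc le_rfl fun j => (he j).2
  have hfin : ∀ z : Fin d → ℝ, volume (K ∩ Icc 0 z) ≠ ⊤ := fun z =>
    ((measure_mono inter_subset_right).trans_lt isCompact_Icc.measure_lt_top).ne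
  have hfin' : ∀ z : Fin d → ℝ, volume (Icc 0 z) ≠ ⊤ := fun z => isCompact_Icc.measure_lt_top.ne
  have hvol : volume.real (K ∩ Icc 0 U) - volume.real (K ∩ Icc 0 L) ≤ d / N := by
    have h1 : volume.real (K ∩ Icc 0 U) - volume.real (K ∩ Icc 0 L) =
        volume.real ((K ∩ Icc 0 U) \ (K ∩ Icc 0 L)) :=
      (measureReal_sdiff (inter_subset_inter_right _ (hsubL.trans hsubU))
        (hK.inter measurableSet_Icc) (hfin U)).symm
    have h2 : volume.real (Icc 0 U \ Icc 0 L) = volume.real (Icc 0 U) - volume.real (Icc 0 L) :=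
      measureReal_sdiff (hsubL.trans hsubU) measurableSet_Icc (hfin' U)
    have h3 : volume.real ((K ∩ Icc 0 U) \ (K ∩ Icc 0 L)) ≤ volume.real (Icc 0 U \ Icc 0 L) :=
      measureReal_mono (fun x hx => ⟨hx.1.2, fun hxL => hx.2 ⟨hx.1.1, hxL⟩⟩)
        ((measure_mono sdiff_subset).trans_lt isCompact_Icc.measure_lt_top).ne
    rw [volume_real_box (fun j => (hL0 j).trans (hLU j)), volume_real_box hL0] at h2
    have h4 := prod_sub_prod_le_card_mul Finset.univ (δ := 1 / N) hL0 hLU hU1 fun j => by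
      show _ / _ - _ / _ ≤ _
      rw [← sub_div, add_sub_cancel_left]
    rw [Finset.card_univ, Fintype.card_fin, mul_one_div] at h4
    linarith
  have hN2 : N * volume.real (K ∩ Icc 0 U) - N * volume.real (K ∩ Icc 0 L) ≤ d := by
    rw [← mul_sub, ← le_div_iff₀' hN']
    exact hvol
  have hmono : ∀ {z w : Fin d → ℝ}, Icc 0 z ⊆ Icc 0 w →
      N * volume.real (K ∩ Icc 0 z) ≤ N * volume.real (K ∩ Icc 0 w) ∧
      ∑ n, (K ∩ Icc 0 z).indicator (fun _ => (1 : ℝ)) (t n) ≤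
        ∑ n, (K ∩ Icc 0 w).indicator (fun _ => (1 : ℝ)) (t n) := by
    intro z w hzw
    refine ⟨mul_le_mul_of_nonneg_left (measureReal_mono (inter_subset_inter_right _ hzw) (hfin w))
      hN'.le, Finset.sum_le_sum fun n _ => ?_⟩
    exact indicator_le_indicator_of_subset (inter_subset_inter_right _ hzw)
      (fun _ => zero_le_one) _
  have hA := hmono hsubL
  have hB := hmono hsubU
  unfold boxError at hbL hbU ⊢
  rw [abs_le] at hbL hbU ⊢
  constructor <;> linarith [hbL.1, hbL.2, hbU.1, hbU.2, hA.1, hA.2, hB.1, hB.2]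

theorem hsfcConst_eq {d : ℕ} (hd : 0 < d) {q : ℝ} (hq : q < 1) :
    hsfcConst d q = d * Real.log 2 + d - Real.log (2 * Real.pi * d) / 2 - Real.log (1 - q) := by
  have hd' : (0 : ℝ) < d := by exact_mod_cast hd
  have h1 : 0 < 1 - q := by linarith
  have hπ := Real.pi_pos
  have h2 : 0 < Real.sqrt (2 * Real.pi * d) := Real.sqrt_pos.2 (by positivity)
  rw [hsfcConst, Real.log_div (by positivity) (by positivity), Real.log_mul h2.ne' h1.ne',
    Real.log_pow, Real.log_mul two_ne_zero (Real.exp_ne_zero 1), Real.log_exp,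
    Real.log_sqrt (by positivity)]
  ring

/-- The logarithm of the square root is removed by `log (2π) ≤ 2` and `log d ≤ d - 1`. -/
theorem hsfcConst_ge {d : ℕ} (hd : 0 < d) {q : ℝ} (hq : q < 1) :
    d * (Real.log 2 + 1 / 2) - 1 / 2 - Real.log (1 - q) ≤ hsfcConst d q := by
  have hd' : (0 : ℝ) < d := by exact_mod_cast hd
  have hπ := Real.pi_pos
  have h1 : Real.log (2 * Real.pi * d) ≤ 2 + (d - 1) := by
    rw [Real.log_mul (by positivity) hd'.ne']
    have h2 : Real.log (2 * Real.pi) ≤ 2 := by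
      rw [Real.log_le_iff_le_exp (by positivity)]
      have h3 : Real.exp 2 = Real.exp 1 * Real.exp 1 := by rw [← Real.exp_add]; norm_num
      have h4 := Real.exp_one_gt_d9
      have h5 := Real.pi_lt_d2
      rw [h3]
      nlinarith
    linarith [Real.log_le_sub_one_of_pos hd']
  rw [hsfcConst_eq hd hq]
  linarith

/-- Numerical comparison: the deviation obtained from Hoeffding's inequality and a union bound over
`2 (N+1)^d` boxes is below the claimed bound. -/
theorem deviation_le_hsfcBound {d N : ℕ} (hd : 0 < d) (hN : 0 < N) {q : ℝ} (hq0 : 0 < q)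
    (hq1 : q < 1) :
    (Real.sqrt (32 * (d * Real.sqrt d) * (N / (N : ℝ) ^ (1 / (d : ℝ))) / 2 *
      (d * Real.log (N + 1) + 2 * Real.log 2 - Real.log (1 - q))) + d) / N ≤ hsfcBound d N q := by
  have hN' : (1 : ℝ) ≤ N := by exact_mod_cast hN
  have hN0 : (0 : ℝ) < N := by linarith
  have hd' : (1 : ℝ) ≤ d := by exact_mod_cast hd
  have hd0 : (0 : ℝ) < d := by linarith
  have hc := hsfcConst_ge hd hq1
  have hlog2 := Real.log_two_gt_d9
  have hlog2' := Real.log_two_lt_d9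
  have hℓ : Real.log (1 - q) ≤ 0 := Real.log_nonpos (by linarith) (by linarith)
  have hL : Real.log 2 ≤ Real.log (N + 1) := Real.log_le_log two_pos (by linarith)
  set c := hsfcConst d q with hcdef
  set ℓ := Real.log (1 - q)
  set L := Real.log ((N : ℝ) + 1)
  have hc0 : 0 ≤ c := by nlinarith
  have hdL : (d : ℝ) * Real.log 2 ≤ d * L := mul_le_mul_of_nonneg_left hL hd0.le
  have hAd : (d : ℝ) ≤ d * L + c := by nlinarith
  -- Here `25 = 5²`. From `c ≥ log 2 - ℓ` and `dL ≥ log 2`, the surplus `9dL + 25c` is at least `34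
  -- log 2 - 25ℓ`, against the required `32 log 2 - 16ℓ`.
  have hA : 16 * (d * L + 2 * Real.log 2 - ℓ) ≤ 25 * (d * L + c) := by nlinarith
  set T : ℝ := (d : ℝ) ^ (3 / 4 : ℝ) * (N / (N : ℝ) ^ (1 / 2 + 1 / (2 * (d : ℝ)))) with hT
  have hT0 : 0 ≤ T := by positivity
  have hT2 : T ^ 2 = d * Real.sqrt d * (N / (N : ℝ) ^ (1 / (d : ℝ))) := by
    have h1 : ((d : ℝ) ^ (3 / 4 : ℝ)) ^ 2 = d * Real.sqrt d := by
      rw [← Real.rpow_natCast, ← Real.rpow_mul hd0.le, Real.sqrt_eq_rpow]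
      nth_rewrite 2 [← Real.rpow_one (d : ℝ)]
      rw [← Real.rpow_add hd0]
      norm_num
    have h2 : ((N : ℝ) ^ (1 / 2 + 1 / (2 * (d : ℝ)))) ^ 2 = N * (N : ℝ) ^ (1 / (d : ℝ)) := by
      rw [← Real.rpow_natCast, ← Real.rpow_mul hN0.le]
      nth_rewrite 2 [← Real.rpow_one (N : ℝ)]
      rw [← Real.rpow_add hN0]
      congr 1
      push_cast
      field_simp
    rw [hT, mul_pow, h1, div_pow, h2]
    have := Real.rpow_pos_of_pos hN0 (1 / (d : ℝ))
    field_simp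
  have hρ : (N : ℝ) ^ (1 / (d : ℝ)) ≤ N := by
    refine Real.rpow_le_self_of_one_le hN' ?_
    rw [div_le_one hd0]
    exact hd'
  have hρ0 : 0 < (N : ℝ) ^ (1 / (d : ℝ)) := Real.rpow_pos_of_pos hN0 _
  have hTd : (d : ℝ) ≤ T ^ 2 := by
    rw [hT2]
    have h1 : 1 ≤ Real.sqrt d := Real.one_le_sqrt.2 hd'
    have h2 : 1 ≤ N / (N : ℝ) ^ (1 / (d : ℝ)) := (one_le_div hρ0).2 hρ
    calc (d : ℝ) = d * 1 * 1 := by ring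
      _ ≤ _ := by gcongr
  have hsqrt : Real.sqrt (32 * (d * Real.sqrt d) * (N / (N : ℝ) ^ (1 / (d : ℝ))) / 2 *
      (d * L + 2 * Real.log 2 - ℓ)) ≤ 5 * T * Real.sqrt (d * L + c) := by
    refine Real.sqrt_le_iff.2 ⟨by positivity, ?_⟩
    rw [mul_pow, Real.sq_sqrt (by linarith)]
    have h1 : 32 * (d * Real.sqrt d) * (N / (N : ℝ) ^ (1 / (d : ℝ))) / 2 = 16 * T ^ 2 := by
      rw [hT2]; ring
    rw [h1]
    nlinarith [mul_le_mul_of_nonneg_left hA (sq_nonneg T)]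
  -- The discretisation loss `d` uses one more multiple of this product, raising 5 to 6. The term
  -- `2c/3` serves only as nonnegative slack.
  have hdT : (d : ℝ) ≤ T * Real.sqrt (d * L + c) := by
    refine le_of_pow_le_pow_left₀ two_ne_zero (by positivity) ?_
    rw [mul_pow, Real.sq_sqrt (by linarith), sq]
    exact mul_le_mul hTd hAd hd0.le (sq_nonneg T)
  have hB : hsfcBound d N q = (6 * T * Real.sqrt (d * L + c) + 2 * c / 3) / N := by
    rw [hsfcBound, hT]
    have := Real.rpow_pos_of_pos hN0 (1 / 2 + 1 / (2 * (d : ℝ)))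
    simp only [← hcdef]
    field_simp
    rfl
  rw [hB]
  refine div_le_div_of_nonneg_right ?_ hN0.le
  linarith

/-- With probability at least `(1+q)/2`, HSFC samples have small counting error in `K ∩ [0,y]`,
uniformly in the box `[0,y]`, for a fixed convex `K`. -/
theorem IsHSFCSample.measureReal_exists_boxError_le {S : Type*} [MeasurableSpace S]
    {P : Measure S} [IsProbabilityMeasure P] {d N : ℕ} (hd : 0 < d) (hN : 0 < N)
    {H : ℝ → Fin d → ℝ} (hH : IsHilbertCurve d H) {X : Fin N → S → Fin d → ℝ}
    (hX : IsHSFCSample P H X) {K : Set (Fin d → ℝ)} (hKm : MeasurableSet K) (hK : Convex ℝ K)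
    (hKs : K ⊆ Icc 0 1) {q : ℝ} (hq0 : 0 < q) (hq1 : q < 1) :
    P.real {s | ∃ y ∈ Icc (0 : Fin d → ℝ) 1,
      hsfcBound d N q < |boxError K (fun n => X n s) y| / N} ≤ (1 - q) / 2 := by
  have hN' : (0 : ℝ) < N := by exact_mod_cast hN
  have hd' : (0 : ℝ) < d := by exact_mod_cast hd
  set R : ℝ := 32 * (d * Real.sqrt d) * (N / (N : ℝ) ^ (1 / (d : ℝ))) with hRdef
  have hR : 0 < R := by
    have := Real.sqrt_pos.2 hd'
    have := Real.rpow_pos_of_pos hN' (1 / (d : ℝ))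
    positivity
  set M : ℝ := d * Real.log (N + 1) + 2 * Real.log 2 - Real.log (1 - q) with hM
  have hM0 : 0 ≤ M := by
    have h1 : Real.log (1 - q) ≤ 0 := Real.log_nonpos (by linarith) (by linarith)
    have h2 : 0 ≤ Real.log ((N : ℝ) + 1) := Real.log_nonneg (by linarith)
    have h3 : 0 ≤ Real.log 2 := Real.log_nonneg one_le_two
    have := mul_nonneg hd'.le h2
    linarith
  set ε := Real.sqrt (R / 2 * M) with hε
  have hdev : (ε + d) / N ≤ hsfcBound d N q := deviation_le_hsfcBound hd hN hq0 hq1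
  -- `ε` is tuned to this value: the factor 4 splits into 2 for the two tails and 2 for the two sets
  -- `K` treated in the end.
  have hexp : Real.exp (-(2 * ε ^ 2 / R)) = (1 - q) / (4 * (N + 1) ^ d) := by
    have h1 : -(2 * ε ^ 2 / R) = Real.log ((1 - q) / (4 * (N + 1) ^ d)) := by
      rw [hε, Real.sq_sqrt (by positivity), Real.log_div (by linarith) (by positivity),
        Real.log_mul (by norm_num) (by positivity), Real.log_pow,
        show (4 : ℝ) = 2 ^ 2 by norm_num, Real.log_pow, hM]
      field_simp
      push_cast
      ring
    rw [h1, Real.exp_log]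
    have : 0 < 1 - q := by linarith
    positivity
  have hsub : {s | ∃ y ∈ Icc (0 : Fin d → ℝ) 1,
      hsfcBound d N q < |boxError K (fun n => X n s) y| / N} ⊆
      ⋃ a : Fin d → Fin (N + 1),
        {s | ε ≤ |boxError K (fun n => X n s) fun j => ((a j : ℕ) : ℝ) / N|} := by
    rintro s ⟨y, hy, hlt⟩
    by_contra hcon
    simp only [mem_iUnion, mem_ofPred_eq, not_exists, not_le] at hcon
    have h1 := abs_boxError_le_of_grid hN hKm (fun n => X n s) (fun a => (hcon a).le) hy
    have h2 : |boxError K (fun n => X n s) y| / N ≤ (ε + d) / N := by gcongr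
    linarith
  refine (measureReal_mono hsub).trans ((measureReal_iUnion_fintype_le _).trans ?_)
  have hterm : ∀ a : Fin d → Fin (N + 1),
      P.real {s | ε ≤ |boxError K (fun n => X n s) fun j => ((a j : ℕ) : ℝ) / N|} ≤
        2 * ((1 - q) / (4 * (N + 1) ^ d)) := by
    intro a
    rw [← hexp]
    exact hX.measureReal_convex_deviation_le hd hN hH
      (hKm.inter measurableSet_Icc) (hK.inter (convex_Icc _ _))
      (inter_subset_left.trans hKs) (Real.sqrt_nonneg _)
  refine (Finset.sum_le_sum fun a _ => hterm a).trans (le_of_eq ?_)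
  rw [Finset.sum_const, Finset.card_univ, Fintype.card_fun, Fintype.card_fin, Fintype.card_fin,
    nsmul_eq_mul]
  push_cast
  field_simp
  ring

/-! ### A Koksma–Hlawka inequality through Peano kernels. -/

/-- Resampling one coordinate preserves a product of probability measures. -/
theorem measurePreserving_update_pi {ι : Type*} [Fintype ι] [DecidableEq ι] (ν : ι → Measure ℝ)
    [∀ i, IsProbabilityMeasure (ν i)] (j : ι) :
    MeasurePreserving (fun p : (ι → ℝ) × ℝ => Function.update p.1 j p.2)
      ((Measure.pi ν).prod (ν j)) (Measure.pi ν) := by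
  have hm : Measurable (fun p : (ι → ℝ) × ℝ => Function.update p.1 j p.2) := by
    refine measurable_pi_iff.2 fun i => ?_
    by_cases hij : i = j
    · subst hij
      simpa using measurable_snd
    · simp only [Function.update_of_ne hij]
      exact (measurable_pi_apply i).comp measurable_fst
  refine ⟨hm, (Measure.pi_eq fun s hs => ?_).symm⟩
  rw [Measure.map_apply hm (MeasurableSet.univ_pi hs)]
  have hpre : (fun p : (ι → ℝ) × ℝ => Function.update p.1 j p.2) ⁻¹' univ.pi s =
      univ.pi (Function.update s j univ) ×ˢ s j := by
    ext p
    simp only [mem_preimage, mem_pi, mem_univ, forall_const, mem_prod]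
    constructor
    · intro h
      refine ⟨fun i => ?_, by simpa using h j⟩
      by_cases hij : i = j
      · subst hij; simp
      · simpa [hij] using h i
    · rintro ⟨h1, h2⟩ i
      by_cases hij : i = j
      · subst hij; simpa using h2
      · simpa [hij] using h1 i
  rw [hpre, Measure.prod_prod, Measure.pi_pi, ← Finset.mul_prod_erase _ _ (Finset.mem_univ j),
    ← Finset.mul_prod_erase _ (fun i => ν i (s i)) (Finset.mem_univ j), Function.update_self,
    measure_univ, one_mul, mul_comm]
  congr 1
  refine Finset.prod_congr rfl fun i hi => ?_
  rw [Function.update_of_ne (Finset.ne_of_mem_erase hi)]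

instance isProbabilityMeasure_unitInterval :
    IsProbabilityMeasure ((volume : Measure ℝ).restrict (Icc 0 1)) :=
  ⟨by rw [Measure.restrict_apply_univ, Real.volume_Icc]; norm_num⟩

theorem volume_restrict_unitCube (d : ℕ) :
    (volume : Measure (Fin d → ℝ)).restrict (Icc 0 1) =
      Measure.pi fun _ => (volume : Measure ℝ).restrict (Icc 0 1) := by
  rw [← Measure.restrict_pi_pi, ← volume_pi]
  congr 1
  exact (pi_univ_Icc 0 1).symm

instance isProbabilityMeasure_unitCube (d : ℕ) :
    IsProbabilityMeasure ((volume : Measure (Fin d → ℝ)).restrict (Icc 0 1)) := by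
  rw [volume_restrict_unitCube]
  infer_instance

/-- The Peano kernel `t - 1_{s ≤ t}` of the mean value formula on `[0,1]`. -/
noncomputable def peanoKernel (s t : ℝ) : ℝ := t - if s ≤ t then 1 else 0

theorem abs_peanoKernel_le {s t : ℝ} (ht : t ∈ Icc (0 : ℝ) 1) : |peanoKernel s t| ≤ 1 := by
  unfold peanoKernel
  rw [abs_le]
  split_ifs <;> constructor <;> linarith [ht.1, ht.2]

theorem measurable_peanoKernel : Measurable fun p : ℝ × ℝ => peanoKernel p.1 p.2 := by
  unfold peanoKernel
  exact measurable_snd.sub (Measurable.ite (measurableSet_le measurable_fst measurable_snd)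
    measurable_const measurable_const)

/-- The integral of `(tφ)'` over `[0,1]` is `φ 1`, and that of `φ'` over `[s,1]` is `φ 1 - φ s`;
subtract. -/
theorem integral_add_peanoKernel_mul {φ ψ : ℝ → ℝ} (hφ : Continuous φ) (hψ : Continuous ψ)
    (hd : ∀ t ∈ Ioo (0 : ℝ) 1, HasDerivAt φ (ψ t) t) {s : ℝ} (hs : s ∈ Icc (0 : ℝ) 1) :
    ∫ t in Icc (0 : ℝ) 1, (φ t + peanoKernel s t * ψ t) = φ s := by
  have hc : Continuous fun t => φ t + t * ψ t := hφ.add (continuous_id.mul hψ)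
  have h1 : ∫ t in Icc (0 : ℝ) 1, (φ t + t * ψ t) = φ 1 := by
    rw [integral_Icc_eq_integral_Ioc, ← intervalIntegral.integral_of_le zero_le_one,
      intervalIntegral.integral_eq_sub_of_hasDerivAt_of_le (f := fun t => t * φ t) zero_le_one
        (continuous_id.mul hφ).continuousOn ?_ (hc.intervalIntegrable 0 1)]
    · simp
    · intro t ht
      have h := (hasDerivAt_id' t).mul (hd t ht)
      rw [one_mul] at h
      exact h
  have h2 : ∫ t in Icc (0 : ℝ) 1, (Ici s).indicator ψ t = φ 1 - φ s := by
    rw [setIntegral_indicator measurableSet_Ici]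
    have : Icc (0 : ℝ) 1 ∩ Ici s = Icc s 1 := by
      ext t
      simp only [mem_inter_iff, mem_Icc, mem_Ici]
      exact ⟨fun h => ⟨h.2, h.1.2⟩, fun h => ⟨⟨hs.1.trans h.1, h.2⟩, h.1⟩⟩
    rw [this, integral_Icc_eq_integral_Ioc, ← intervalIntegral.integral_of_le hs.2]
    exact intervalIntegral.integral_eq_sub_of_hasDerivAt_of_le hs.2 hφ.continuousOn
      (fun t ht => hd t ⟨hs.1.trans_lt ht.1, ht.2⟩) (hψ.intervalIntegrable s 1)
  have h3 : ∀ t, φ t + peanoKernel s t * ψ t = (φ t + t * ψ t) - (Ici s).indicator ψ t := by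
    intro t
    unfold peanoKernel indicator
    simp only [mem_Ici]
    split_ifs <;> ring
  simp only [h3]
  rw [integral_sub (hc.continuousOn.integrableOn_compact isCompact_Icc)
    ((hψ.continuousOn.integrableOn_compact isCompact_Icc).indicator measurableSet_Ici), h1, h2]
  ring

theorem abs_prod_peanoKernel_le {d : ℕ} (u : Finset (Fin d)) (x : Fin d → ℝ) {y : Fin d → ℝ}
    (hy : y ∈ Icc (0 : Fin d → ℝ) 1) : |∏ j ∈ u, peanoKernel (x j) (y j)| ≤ 1 := by
  rw [Finset.abs_prod]
  exact Finset.prod_le_one (fun _ _ => abs_nonneg _)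
    fun j _ => abs_peanoKernel_le ⟨hy.1 j, hy.2 j⟩

theorem measurable_prod_peanoKernel {d : ℕ} (u : Finset (Fin d)) :
    Measurable fun p : (Fin d → ℝ) × (Fin d → ℝ) => ∏ j ∈ u, peanoKernel (p.1 j) (p.2 j) :=
  Finset.measurable_fun_prod _ fun j _ => Measurable.comp (g := fun p : ℝ × ℝ => peanoKernel p.1 p.2)
    (f := fun p : (Fin d → ℝ) × (Fin d → ℝ) => (p.1 j, p.2 j)) measurable_peanoKernel
    (((measurable_pi_apply j).comp measurable_fst).prodMk
      ((measurable_pi_apply j).comp measurable_snd))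

theorem integrable_mul_prod_peanoKernel {d : ℕ} {g : (Fin d → ℝ) → ℝ} (hg : Continuous g)
    (u : Finset (Fin d)) (x : Fin d → ℝ) :
    IntegrableOn (fun y => g y * ∏ j ∈ u, peanoKernel (x j) (y j)) (Icc 0 1) := by
  refine Integrable.mul_bdd (c := 1) (hg.continuousOn.integrableOn_compact isCompact_Icc) ?_ ?_
  · exact ((measurable_prod_peanoKernel u).comp
      (measurable_const.prodMk measurable_id)).aestronglyMeasurable
  · filter_upwards [ae_restrict_mem measurableSet_Icc] with y hy
    exact abs_prod_peanoKernel_le u x hy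

/-- A multivariate mean value formula: if `F (insert j u)` is the partial derivative of `F u` in
direction `j` (for `j` below `u`), then `F ∅` is recovered from the averages of the `F u` against
the Peano kernels. -/
theorem eq_sum_integral_prod_peanoKernel {d : ℕ} (F : Finset (Fin d) → (Fin d → ℝ) → ℝ)
    (hF : ∀ u, Continuous (F u))
    (hd : ∀ (j : Fin d) (u : Finset (Fin d)), (∀ i ∈ u, j < i) → ∀ x ∈ Icc (0 : Fin d → ℝ) 1,
      ∀ t ∈ Ioo (0 : ℝ) 1, HasDerivAt (fun t => F u (Function.update x j t))
        (F (insert j u) (Function.update x j t)) t)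
    {x : Fin d → ℝ} (hx : x ∈ Icc (0 : Fin d → ℝ) 1) :
    F ∅ x = ∑ u : Finset (Fin d),
      ∫ y in Icc (0 : Fin d → ℝ) 1, F u y * ∏ j ∈ u, peanoKernel (x j) (y j) := by
  -- coordinates are integrated out one after the other, starting from the last one
  let mix : ℕ → (Fin d → ℝ) → Fin d → ℝ := fun m y j => if (j : ℕ) < m then x j else y j
  have hmixc : ∀ m, Continuous (mix m) := fun m => continuous_pi fun j => by
    by_cases h : (j : ℕ) < m
    · simpa only [mix, if_pos h] using continuous_const
    · simpa only [mix, if_neg h] using continuous_apply j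
  have hmixmem : ∀ m, ∀ y ∈ Icc (0 : Fin d → ℝ) 1, mix m y ∈ Icc (0 : Fin d → ℝ) 1 := by
    intro m y hy
    constructor <;> intro j <;> by_cases h : (j : ℕ) < m <;> simp only [mix, h, if_true, if_false]
    exacts [hx.1 j, hy.1 j, hx.2 j, hy.2 j]
  have key : ∀ k ≤ d, F ∅ x =
      ∑ u ∈ (Finset.univ.filter fun j : Fin d => d - k ≤ (j : ℕ)).powerset,
        ∫ y in Icc (0 : Fin d → ℝ) 1,
          F u (mix (d - k) y) * ∏ j ∈ u, peanoKernel (x j) (y j) := by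
    intro k
    induction k with
    | zero =>
      intro _
      have h1 : (Finset.univ.filter fun j : Fin d => d - 0 ≤ (j : ℕ)) = ∅ := by
        ext j
        simp
      have h2 : ∀ y, mix (d - 0) y = x := fun y => by
        ext j
        simp [mix]
      rw [h1, Finset.powerset_empty, Finset.sum_singleton]
      simp only [h2, Finset.prod_empty, mul_one, integral_const, probReal_univ, one_smul]
    | succ k ih =>
      intro hk
      rw [ih (by omega)]
      have hm : d - k = d - (k + 1) + 1 := by omega
      set m := d - (k + 1) with hmdef
      have hmd : m < d := by omega
      rw [hm]
      set j : Fin d := ⟨m, hmd⟩ with hj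
      have hset : (Finset.univ.filter fun i : Fin d => m ≤ (i : ℕ)) =
          insert j (Finset.univ.filter fun i : Fin d => m + 1 ≤ (i : ℕ)) := by
        ext i
        simp only [Finset.mem_filter, Finset.mem_univ, true_and, Finset.mem_insert, hj, Fin.ext_iff]
        omega
      have hjn : j ∉ Finset.univ.filter fun i : Fin d => m + 1 ≤ (i : ℕ) := by simp [hj]
      rw [hset, Finset.sum_powerset_insert hjn, ← Finset.sum_add_distrib]
      refine Finset.sum_congr rfl fun u hu => ?_
      have hju : ∀ i ∈ u, j < i := fun i hi => by
        have := (Finset.mem_filter.1 (Finset.mem_powerset.1 hu hi)).2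
        rw [Fin.lt_def]
        exact this
      have hjnu : j ∉ u := fun h => lt_irrefl j (hju j h)
      have hG1 := integrable_mul_prod_peanoKernel ((hF u).comp (hmixc m)) u x
      have hG2 := integrable_mul_prod_peanoKernel ((hF (insert j u)).comp (hmixc m)) (insert j u) x
      let G : (Fin d → ℝ) → ℝ := fun y => F u (mix m y) * ∏ i ∈ u, peanoKernel (x i) (y i) +
        F (insert j u) (mix m y) * ∏ i ∈ insert j u, peanoKernel (x i) (y i)
      have hG : Integrable G (volume.restrict (Icc 0 1)) := hG1.add hG2
      refine Eq.trans ?_ (integral_add hG1 hG2)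
      -- Resampling coordinate `j` isolates it as an inner one-dimensional integral without
      -- splitting the product space.
      have hmp := measurePreserving_update_pi
        (fun _ : Fin d => (volume : Measure ℝ).restrict (Icc 0 1)) j
      rw [← volume_restrict_unitCube] at hmp
      have hGm := hG.aestronglyMeasurable
      rw [← hmp.map_eq] at hGm
      have hint : Integrable (fun p : (Fin d → ℝ) × ℝ => G (Function.update p.1 j p.2))
          (((volume : Measure (Fin d → ℝ)).restrict (Icc 0 1)).prod
            (volume.restrict (Icc 0 1))) :=
        hmp.integrable_comp_of_integrable hG
      have hGint : ∫ y in Icc (0 : Fin d → ℝ) 1, G y =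
          ∫ y in Icc (0 : Fin d → ℝ) 1, ∫ t in Icc (0 : ℝ) 1, G (Function.update y j t) := by
        rw [← integral_prod _ hint, ← integral_map hmp.measurable.aemeasurable hGm, hmp.map_eq]
      refine Eq.trans ?_ hGint.symm
      refine setIntegral_congr_fun measurableSet_Icc fun y hy => ?_
      have hupd : ∀ t, mix m (Function.update y j t) = Function.update (mix (m + 1) y) j t := by
        intro t
        ext i
        by_cases hij : i = j
        · subst hij
          simp [mix, hj]
        · have : ((i : ℕ) < m) ↔ ((i : ℕ) < m + 1) := by
            have : (i : ℕ) ≠ m := fun h => hij (Fin.ext h)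
            omega
          simp only [mix, Function.update_of_ne hij, this]
      have hprod : ∀ t, ∏ i ∈ u, peanoKernel (x i) (Function.update y j t i) =
          ∏ i ∈ u, peanoKernel (x i) (y i) := fun t => Finset.prod_congr rfl fun i hi => by
        rw [Function.update_of_ne (hju i hi).ne']
      have hGu : ∀ t, G (Function.update y j t) = (F u (Function.update (mix (m + 1) y) j t) +
          peanoKernel (x j) t * F (insert j u) (Function.update (mix (m + 1) y) j t)) *
          ∏ i ∈ u, peanoKernel (x i) (y i) := by
        intro t
        simp only [G, hupd, Finset.prod_insert hjnu, hprod, Function.update_self]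
        ring
      simp only [hGu]
      rw [integral_mul_const]
      have hcont : Continuous fun t : ℝ => Function.update (mix (m + 1) y) j t :=
        continuous_const.update j continuous_id
      have h1D := integral_add_peanoKernel_mul ((hF u).comp hcont) ((hF (insert j u)).comp hcont)
        (hd j u hju _ (hmixmem (m + 1) y hy)) (s := x j) ⟨hx.1 j, hx.2 j⟩
      simp only [Function.comp_def] at h1D
      rw [h1D]
      have hself : Function.update (mix (m + 1) y) j (x j) = mix (m + 1) y := by
        rw [Function.update_eq_self_iff]
        simp [mix, hj]
      rw [hself]
  have h := key d le_rfl
  have h1 : (Finset.univ.filter fun j : Fin d => d - d ≤ (j : ℕ)) = Finset.univ := by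
    ext j
    simp
  have h2 : ∀ y, mix (d - d) y = y := fun y => by
    ext j
    simp [mix]
  rw [h1, Finset.powerset_univ] at h
  simpa only [h2] using h

/-- Expanding the product of `y_j - 1_{x_j ≤ y_j}` leaves indicators of anchored boxes, so `ν`
enters only through its values on boxes. There are `2^{|u|}` terms, the source of that factor in the
inequality below. -/
theorem integral_prod_peanoKernel {d : ℕ} (ν : Measure (Fin d → ℝ)) [IsFiniteMeasure ν]
    (hν : ∀ᵐ x ∂ν, x ∈ Icc (0 : Fin d → ℝ) 1) (u : Finset (Fin d)) (y : Fin d → ℝ) :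
    ∫ x, ∏ j ∈ u, peanoKernel (x j) (y j) ∂ν =
      ∑ w ∈ u.powerset, (-1) ^ w.card * (∏ j ∈ u \ w, y j) *
        ν.real (Icc 0 fun j => if j ∈ w then y j else 1) := by
  have h1 : ∀ x : Fin d → ℝ, ∏ j ∈ u, peanoKernel (x j) (y j) = ∑ w ∈ u.powerset,
      (-1) ^ w.card * (∏ j ∈ u \ w, y j) * ∏ j ∈ w, (if x j ≤ y j then (1 : ℝ) else 0) := by
    intro x
    unfold peanoKernel
    rw [Finset.prod_sub]
  have h2 : ∀ w : Finset (Fin d), (fun x : Fin d → ℝ => ∏ j ∈ w, (if x j ≤ y j then (1 : ℝ) else 0))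
      =ᵐ[ν] (Icc 0 fun j => if j ∈ w then y j else 1).indicator fun _ => 1 := by
    intro w
    filter_upwards [hν] with x hx
    rw [Finset.prod_ite_zero]
    have hiff : (∀ j ∈ w, x j ≤ y j) ↔ x ∈ Icc 0 fun j => if j ∈ w then y j else 1 := by
      constructor
      · intro h
        refine ⟨hx.1, fun j => ?_⟩
        by_cases hj : j ∈ w
        · simpa only [if_pos hj] using h j hj
        · simpa only [if_neg hj, Pi.one_apply] using hx.2 j
      · intro h j hj
        simpa only [if_pos hj] using h.2 j
    by_cases h : ∀ j ∈ w, x j ≤ y j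
    · rw [if_pos h, indicator_of_mem (hiff.1 h), Finset.prod_const_one]
    · rw [if_neg h, indicator_of_notMem (mt hiff.2 h)]
  have h3 : ∀ w : Finset (Fin d), Integrable
      (fun x : Fin d → ℝ => ∏ j ∈ w, (if x j ≤ y j then (1 : ℝ) else 0)) ν := fun w =>
    ((integrable_const (1 : ℝ)).indicator measurableSet_Icc).congr (h2 w).symm
  simp only [h1]
  rw [integral_finsetSum _ fun w _ => (h3 w).const_mul _]
  refine Finset.sum_congr rfl fun w _ => ?_
  rw [integral_const_mul, integral_congr_ae (h2 w), integral_indicator measurableSet_Icc]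
  simp

theorem integral_eq_sum_integral_mul {d : ℕ} (F : Finset (Fin d) → (Fin d → ℝ) → ℝ)
    (hF : ∀ u, Continuous (F u))
    (hd : ∀ (j : Fin d) (u : Finset (Fin d)), (∀ i ∈ u, j < i) → ∀ x ∈ Icc (0 : Fin d → ℝ) 1,
      ∀ t ∈ Ioo (0 : ℝ) 1, HasDerivAt (fun t => F u (Function.update x j t))
        (F (insert j u) (Function.update x j t)) t)
    (ν : Measure (Fin d → ℝ)) [IsFiniteMeasure ν] (hν : ∀ᵐ x ∂ν, x ∈ Icc (0 : Fin d → ℝ) 1) :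
    ∫ x, F ∅ x ∂ν = ∑ u : Finset (Fin d), ∫ y in Icc (0 : Fin d → ℝ) 1,
      F u y * ∫ x, ∏ j ∈ u, peanoKernel (x j) (y j) ∂ν ∧
    ∀ u, IntegrableOn (fun y => F u y * ∫ x, ∏ j ∈ u, peanoKernel (x j) (y j) ∂ν) (Icc 0 1) := by
  have hint : ∀ u, Integrable (fun p : (Fin d → ℝ) × (Fin d → ℝ) =>
      F u p.2 * ∏ j ∈ u, peanoKernel (p.1 j) (p.2 j)) (ν.prod (volume.restrict (Icc 0 1))) := by
    intro u
    refine Integrable.mul_bdd (c := 1) ?_ (measurable_prod_peanoKernel u).aestronglyMeasurable ?_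
    · exact Integrable.comp_snd ((hF u).continuousOn.integrableOn_compact isCompact_Icc) ν
    · have : ∀ᵐ p ∂(ν.prod ((volume : Measure (Fin d → ℝ)).restrict (Icc 0 1))),
          p.2 ∈ Icc (0 : Fin d → ℝ) 1 :=
        Measure.quasiMeasurePreserving_snd.ae (ae_restrict_mem measurableSet_Icc)
      filter_upwards [this] with p hp
      exact abs_prod_peanoKernel_le u p.1 hp
  constructor
  · have h1 : ∫ x, F ∅ x ∂ν = ∫ x, ∑ u : Finset (Fin d), (∫ y in Icc (0 : Fin d → ℝ) 1,
        F u y * ∏ j ∈ u, peanoKernel (x j) (y j)) ∂ν := by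
      refine integral_congr_ae ?_
      filter_upwards [hν] with x hx
      exact eq_sum_integral_prod_peanoKernel F hF hd hx
    rw [h1, integral_finsetSum _ fun u _ => (hint u).integral_prod_left]
    refine Finset.sum_congr rfl fun u _ => ?_
    rw [integral_integral_swap (hint u)]
    simp only [integral_const_mul]
  · intro u
    have h := (hint u).integral_prod_right
    simp only [integral_const_mul] at h
    exact h

/-- A Koksma–Hlawka inequality for two finite measures on the unit cube. -/
theorem abs_integral_sub_integral_le {d : ℕ} (F : Finset (Fin d) → (Fin d → ℝ) → ℝ)
    (hF : ∀ u, Continuous (F u))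
    (hd : ∀ (j : Fin d) (u : Finset (Fin d)), (∀ i ∈ u, j < i) → ∀ x ∈ Icc (0 : Fin d → ℝ) 1,
      ∀ t ∈ Ioo (0 : ℝ) 1, HasDerivAt (fun t => F u (Function.update x j t))
        (F (insert j u) (Function.update x j t)) t)
    (ν₁ ν₂ : Measure (Fin d → ℝ)) [IsFiniteMeasure ν₁] [IsFiniteMeasure ν₂]
    (hν₁ : ∀ᵐ x ∂ν₁, x ∈ Icc (0 : Fin d → ℝ) 1) (hν₂ : ∀ᵐ x ∂ν₂, x ∈ Icc (0 : Fin d → ℝ) 1)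
    {D : ℝ} (hD : ∀ y ∈ Icc (0 : Fin d → ℝ) 1, |ν₁.real (Icc 0 y) - ν₂.real (Icc 0 y)| ≤ D) :
    |∫ x, F ∅ x ∂ν₁ - ∫ x, F ∅ x ∂ν₂| ≤
      D * ∑ u : Finset (Fin d), 2 ^ u.card * ∫ y in Icc (0 : Fin d → ℝ) 1, |F u y| := by
  obtain ⟨h1, hi1⟩ := integral_eq_sum_integral_mul F hF hd ν₁ hν₁
  obtain ⟨h2, hi2⟩ := integral_eq_sum_integral_mul F hF hd ν₂ hν₂
  rw [h1, h2, ← Finset.sum_sub_distrib, Finset.mul_sum]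
  refine (Finset.abs_sum_le_sum_abs _ _).trans (Finset.sum_le_sum fun u _ => ?_)
  rw [← integral_sub (hi1 u) (hi2 u), ← mul_assoc, ← integral_const_mul, ← Real.norm_eq_abs]
  refine norm_integral_le_of_norm_le
    (((hF u).abs.continuousOn.integrableOn_compact isCompact_Icc).const_mul _) ?_
  filter_upwards [ae_restrict_mem measurableSet_Icc] with y hy
  rw [← mul_sub, Real.norm_eq_abs, abs_mul, mul_comm]
  refine mul_le_mul_of_nonneg_right ?_ (abs_nonneg _)
  rw [integral_prod_peanoKernel ν₁ hν₁, integral_prod_peanoKernel ν₂ hν₂,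
    ← Finset.sum_sub_distrib]
  refine (Finset.abs_sum_le_sum_abs _ _).trans ?_
  have hterm : ∀ w ∈ u.powerset, |(-1) ^ w.card * (∏ j ∈ u \ w, y j) *
        ν₁.real (Icc 0 fun j => if j ∈ w then y j else 1) -
      (-1) ^ w.card * (∏ j ∈ u \ w, y j) *
        ν₂.real (Icc 0 fun j => if j ∈ w then y j else 1)| ≤ D := by
    intro w _
    rw [← mul_sub, abs_mul, abs_mul, abs_pow, abs_neg, abs_one, one_pow, one_mul]
    have hprod : |∏ j ∈ u \ w, y j| ≤ 1 := by
      rw [Finset.abs_prod]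
      refine Finset.prod_le_one (fun _ _ => abs_nonneg _) fun j _ => ?_
      rw [abs_of_nonneg (hy.1 j)]
      exact hy.2 j
    have hbox := hD (fun j => if j ∈ w then y j else 1) (by
      constructor <;> intro j <;> by_cases hj : j ∈ w <;> simp only [hj, if_true, if_false]
      exacts [hy.1 j, zero_le_one, hy.2 j, le_rfl])
    exact (mul_le_of_le_one_left (abs_nonneg _) hprod).trans hbox
  refine (Finset.sum_le_sum hterm).trans (le_of_eq ?_)
  rw [Finset.sum_const, Finset.card_powerset, nsmul_eq_mul]
  push_cast
  ring

/-! ### Mixed partial derivatives on the closed cube. -/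

theorem uniqueDiffOn_unitCube (d : ℕ) : UniqueDiffOn ℝ (Icc (0 : Fin d → ℝ) 1) := by
  rw [← pi_univ_Icc]
  exact UniqueDiffOn.univ_pi fun i => uniqueDiffOn_Icc zero_lt_one

theorem mixedPartial_of_card_eq {d k : ℕ} {u : Finset (Fin d)} (h : u.card = k)
    (f : (Fin d → ℝ) → ℝ) (x : Fin d → ℝ) :
    mixedPartial u f x = iteratedFDerivWithin ℝ k f (Icc 0 1) x
      fun i => Pi.single (u.orderEmbOfFin h i) (1 : ℝ) := by
  subst h
  rfl

theorem mixedPartial_empty {d : ℕ} (f : (Fin d → ℝ) → ℝ) : mixedPartial ∅ f = f := by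
  ext x
  rw [mixedPartial_of_card_eq Finset.card_empty, iteratedFDerivWithin_zero_apply]

theorem continuousOn_mixedPartial {d : ℕ} {f : (Fin d → ℝ) → ℝ} (hf : ContDiffOn ℝ d f (Icc 0 1))
    (u : Finset (Fin d)) : ContinuousOn (mixedPartial u f) (Icc 0 1) := by
  have hu : u.card ≤ d := by simpa using u.card_le_univ
  have h := hf.continuousOn_iteratedFDerivWithin (m := u.card) (by exact_mod_cast hu)
    (uniqueDiffOn_unitCube d)
  exact (ContinuousMultilinearMap.apply ℝ (fun _ : Fin u.card => Fin d → ℝ) ℝ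
    fun k => Pi.single (u.orderEmbOfFin rfl k) (1 : ℝ)).continuous.comp_continuousOn h

/-- The mixed partials along `u` and along `insert j u`, with `j` below `u`, are related by
differentiation in direction `j`. -/
theorem hasFDerivWithinAt_mixedPartial {d : ℕ} {f : (Fin d → ℝ) → ℝ}
    (hf : ContDiffOn ℝ d f (Icc 0 1)) {j : Fin d} {u : Finset (Fin d)} (hju : ∀ i ∈ u, j < i)
    {x : Fin d → ℝ} (hx : x ∈ Icc (0 : Fin d → ℝ) 1) :
    ∃ L : (Fin d → ℝ) →L[ℝ] ℝ, HasFDerivWithinAt (mixedPartial u f) L (Icc 0 1) x ∧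
      L (Pi.single j 1) = mixedPartial (insert j u) f x := by
  have hjnu : j ∉ u := fun h => lt_irrefl j (hju j h)
  have hcard : (insert j u).card = u.card + 1 := Finset.card_insert_of_notMem hjnu
  have hlt : u.card < d := by
    have : (insert j u).card ≤ d := by simpa using (insert j u).card_le_univ
    omega
  have hdiff := hf.differentiableOn_iteratedFDerivWithin (m := u.card) (by exact_mod_cast hlt)
    (uniqueDiffOn_unitCube d) x hx
  let A := ContinuousMultilinearMap.apply ℝ (fun _ : Fin u.card => Fin d → ℝ) ℝ
    fun k => Pi.single (u.orderEmbOfFin rfl k) (1 : ℝ)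
  refine ⟨A.comp (fderivWithin ℝ (iteratedFDerivWithin ℝ u.card f (Icc 0 1)) (Icc 0 1) x),
    A.hasFDerivAt.comp_hasFDerivWithinAt x hdiff.hasFDerivWithinAt, ?_⟩
  -- As `j` precedes `u`, it occupies the first slot, which is that of the outermost derivative; no
  -- symmetry of derivatives is needed.
  have hemb : (Fin.cons j (u.orderEmbOfFin rfl) : Fin (u.card + 1) → Fin d) =
      (insert j u).orderEmbOfFin hcard := by
    refine Finset.orderEmbOfFin_unique hcard (fun i => ?_) ?_
    · refine Fin.cases ?_ (fun i => ?_) i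
      · simp
      · rw [Fin.cons_succ]
        exact Finset.mem_insert_of_mem (Finset.orderEmbOfFin_mem _ _ _)
    · rw [Fin.strictMono_cons]
      exact ⟨fun i => hju _ (Finset.orderEmbOfFin_mem _ _ _), (u.orderEmbOfFin rfl).strictMono⟩
  rw [mixedPartial_of_card_eq hcard, iteratedFDerivWithin_succ_apply_left, ← hemb]
  rfl

/-- The retraction of `ℝ^d` onto the unit cube. -/
def clampCube {d : ℕ} (x : Fin d → ℝ) : Fin d → ℝ := fun j => max 0 (min 1 (x j))

theorem continuous_clampCube {d : ℕ} : Continuous (clampCube (d := d)) := by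
  unfold clampCube
  fun_prop

theorem clampCube_mem {d : ℕ} (x : Fin d → ℝ) : clampCube x ∈ Icc (0 : Fin d → ℝ) 1 :=
  ⟨fun _ => le_max_left _ _, fun _ => max_le zero_le_one (min_le_left _ _)⟩

theorem clampCube_of_mem {d : ℕ} {x : Fin d → ℝ} (hx : x ∈ Icc (0 : Fin d → ℝ) 1) :
    clampCube x = x := by
  ext j
  rw [clampCube, min_eq_right (show x j ≤ 1 from hx.2 j), max_eq_right (show 0 ≤ x j from hx.1 j)]

theorem update_mem_unitCube {d : ℕ} {x : Fin d → ℝ} (hx : x ∈ Icc (0 : Fin d → ℝ) 1) (j : Fin d)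
    {t : ℝ} (ht : t ∈ Icc (0 : ℝ) 1) : Function.update x j t ∈ Icc (0 : Fin d → ℝ) 1 := by
  constructor <;> intro i <;> by_cases hij : i = j
  · subst hij; simpa using ht.1
  · simpa [hij] using hx.1 i
  · subst hij; simpa using ht.2
  · simpa [hij] using hx.2 i

/-- Composing with the retraction makes the partials continuous on the whole space, as the mean
value formula demands, without changing them on the cube. -/
theorem hasDerivAt_mixedPartial_clampCube {d : ℕ} {f : (Fin d → ℝ) → ℝ}
    (hf : ContDiffOn ℝ d f (Icc 0 1)) (j : Fin d) (u : Finset (Fin d)) (hju : ∀ i ∈ u, j < i)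
    (x : Fin d → ℝ) (hx : x ∈ Icc (0 : Fin d → ℝ) 1) (t : ℝ) (ht : t ∈ Ioo (0 : ℝ) 1) :
    HasDerivAt (fun t => mixedPartial u f (clampCube (Function.update x j t)))
      (mixedPartial (insert j u) f (clampCube (Function.update x j t))) t := by
  have hmem : ∀ s ∈ Icc (0 : ℝ) 1, Function.update x j s ∈ Icc (0 : Fin d → ℝ) 1 :=
    fun s hs => update_mem_unitCube hx j hs
  have ht' := Ioo_subset_Icc_self ht
  obtain ⟨L, hL, hLj⟩ := hasFDerivWithinAt_mixedPartial hf hju (hmem t ht')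
  have h1 := hL.comp_hasDerivWithinAt t (hasDerivAt_update x j t).hasDerivWithinAt
    (s := Icc 0 1) hmem
  rw [hLj] at h1
  have h2 := h1.hasDerivAt (Icc_mem_nhds ht.1 ht.2)
  rw [clampCube_of_mem (hmem t ht')]
  refine h2.congr_of_eventuallyEq ?_
  filter_upwards [Icc_mem_nhds ht.1 ht.2] with s hs
  rw [clampCube_of_mem (hmem s hs)]
  rfl

/-- Koksma–Hlawka inequality for functions of class `C^d` on the cube and two finite measures. -/
theorem abs_integral_sub_integral_le_cubeVariation {d : ℕ} {f : (Fin d → ℝ) → ℝ}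
    (hf : ContDiffOn ℝ d f (Icc 0 1)) (ν₁ ν₂ : Measure (Fin d → ℝ)) [IsFiniteMeasure ν₁]
    [IsFiniteMeasure ν₂] (hν₁ : ∀ᵐ x ∂ν₁, x ∈ Icc (0 : Fin d → ℝ) 1)
    (hν₂ : ∀ᵐ x ∂ν₂, x ∈ Icc (0 : Fin d → ℝ) 1) {D : ℝ}
    (hD : ∀ y ∈ Icc (0 : Fin d → ℝ) 1, |ν₁.real (Icc 0 y) - ν₂.real (Icc 0 y)| ≤ D) :
    |∫ x, f x ∂ν₁ - ∫ x, f x ∂ν₂| ≤ 2 ^ d * D * cubeVariation f := by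
  have h := abs_integral_sub_integral_le (fun u x => mixedPartial u f (clampCube x))
    (fun u => (continuousOn_mixedPartial hf u).comp_continuous continuous_clampCube clampCube_mem)
    (hasDerivAt_mixedPartial_clampCube hf) ν₁ ν₂ hν₁ hν₂ hD
  have hint : ∀ ν : Measure (Fin d → ℝ), (∀ᵐ x ∂ν, x ∈ Icc (0 : Fin d → ℝ) 1) →
      ∫ x, mixedPartial ∅ f (clampCube x) ∂ν = ∫ x, f x ∂ν := by
    intro ν hν
    refine integral_congr_ae ?_
    filter_upwards [hν] with x hx
    rw [clampCube_of_mem hx, mixedPartial_empty]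
  rw [hint ν₁ hν₁, hint ν₂ hν₂] at h
  refine h.trans ?_
  have hD0 : 0 ≤ D := (abs_nonneg _).trans (hD 0 ⟨le_rfl, zero_le_one⟩)
  rw [cubeVariation, mul_comm (2 ^ d) D, mul_assoc, Finset.mul_sum (a := (2 : ℝ) ^ d)]
  refine mul_le_mul_of_nonneg_left (Finset.sum_le_sum fun u _ => ?_) hD0
  have hu : u.card ≤ d := by simpa using u.card_le_univ
  have hI : ∫ y in Icc (0 : Fin d → ℝ) 1, |mixedPartial u f (clampCube y)| =
      ∫ y in Icc (0 : Fin d → ℝ) 1, |mixedPartial u f y| :=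
    setIntegral_congr_fun measurableSet_Icc fun y hy => by
      simp only [clampCube_of_mem hy]
  rw [hI, ← mul_assoc]
  refine mul_le_mul_of_nonneg_right ?_ (integral_nonneg fun y => abs_nonneg _)
  -- The claimed weights are generous: `2^{|u|} ≤ 2^d ≤ 2^d · 2^{d-|u|}`.
  have h1 : (2 : ℝ) ^ u.card ≤ 2 ^ d := pow_le_pow_right₀ one_le_two hu
  have h2 : (1 : ℝ) ≤ 2 ^ (d - u.card) := one_le_pow₀ one_le_two
  nlinarith [pow_pos (two_pos : (0 : ℝ) < 2) d]

/-! ### From box errors to discrepancy and quadrature. -/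

/-- Koksma–Hlawka inequality for the equal weight quadrature of `f · 1_K`. -/
theorem abs_quadrature_sub_integral_le {d N : ℕ} (hN : 0 < N) {f : (Fin d → ℝ) → ℝ}
    (hf : ContDiffOn ℝ d f (Icc 0 1)) {K : Set (Fin d → ℝ)} (hK : MeasurableSet K)
    (hKs : K ⊆ Icc 0 1) (t : Fin N → Fin d → ℝ) {D : ℝ}
    (hD : ∀ y ∈ Icc (0 : Fin d → ℝ) 1, |boxError K t y| / N ≤ D) :
    |(∑ n, K.indicator f (t n)) / N - ∫ x in K, f x| ≤ 2 ^ d * D * cubeVariation f := by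
  classical
  have hN' : (0 : ℝ) < N := by exact_mod_cast hN
  -- The indicator of `K` becomes part of both measures, which are then compared on boxes by
  -- `boxError K`.
  let ν₁ : Measure (Fin d → ℝ) := ∑ n : Fin N, (if t n ∈ K then (N : NNReal)⁻¹ else 0) •
    Measure.dirac (t n)
  have hfin : IsFiniteMeasure ((volume : Measure (Fin d → ℝ)).restrict K) :=
    ⟨by rw [Measure.restrict_apply_univ]
        exact (measure_mono hKs).trans_lt isCompact_Icc.measure_lt_top⟩
  have hfin₁ : IsFiniteMeasure ν₁ := by
    dsimp only [ν₁]
    infer_instance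
  have hint : ∀ g : (Fin d → ℝ) → ℝ, ∫ x, g x ∂ν₁ = (∑ n, K.indicator g (t n)) / N := by
    intro g
    rw [integral_finsetSum_measure fun n _ => (integrable_dirac (by simp)).smul_measure_nnreal,
      Finset.sum_div]
    refine Finset.sum_congr rfl fun n _ => ?_
    rw [integral_smul_nnreal_measure, integral_dirac]
    by_cases h : t n ∈ K
    · rw [if_pos h, indicator_of_mem h, NNReal.smul_def, smul_eq_mul]
      push_cast
      ring
    · rw [if_neg h, indicator_of_notMem h, zero_smul, zero_div]
  have hreal : ∀ B, MeasurableSet B →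
      ν₁.real B = (∑ n, (K ∩ B).indicator (fun _ => (1 : ℝ)) (t n)) / N := by
    intro B hB
    have h := hint (B.indicator fun _ => 1)
    rw [integral_indicator hB] at h
    simp only [indicator_indicator] at h
    rw [← h]
    simp
  have hν₁ : ∀ᵐ x ∂ν₁, x ∈ Icc (0 : Fin d → ℝ) 1 := by
    have h := hreal (Icc 0 1)ᶜ measurableSet_Icc.compl
    have hempty : K ∩ (Icc 0 1)ᶜ = ∅ := by
      rw [← sdiff_eq, sdiff_eq_empty.2 hKs]
    rw [hempty, indicator_empty] at h
    simp only [Finset.sum_const_zero, zero_div] at h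
    rw [measureReal_eq_zero_iff] at h
    exact h
  have hν₂ : ∀ᵐ x ∂((volume : Measure (Fin d → ℝ)).restrict K), x ∈ Icc (0 : Fin d → ℝ) 1 := by
    filter_upwards [ae_restrict_mem hK] with x hx using hKs hx
  have h := abs_integral_sub_integral_le_cubeVariation hf ν₁ (volume.restrict K) hν₁ hν₂
    (D := D) fun y hy => by
      refine le_of_eq_of_le ?_ (hD y hy)
      rw [hreal _ measurableSet_Icc, measureReal_restrict_apply measurableSet_Icc,
        ← abs_of_pos hN', ← abs_div, abs_of_pos hN', boxError, inter_comm (Icc 0 y) K]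
      congr 1
      field_simp
  rwa [hint f] at h

theorem starDiscrepancy_le_of_boxError {d N : ℕ} (hN : 0 < N) {t : Fin N → Fin d → ℝ} {D : ℝ}
    (hD : ∀ y ∈ Icc (0 : Fin d → ℝ) 1, |boxError (Icc 0 1) t y| / N ≤ D) :
    starDiscrepancy t ≤ D := by
  classical
  have hN' : (0 : ℝ) < N := by exact_mod_cast hN
  have : Nonempty (Icc (0 : Fin d → ℝ) 1) := ⟨0, le_rfl, zero_le_one⟩
  refine ciSup_le fun y => le_of_eq_of_le ?_ (hD y y.2)
  have hsub : Icc (0 : Fin d → ℝ) 1 ∩ Icc 0 (y : Fin d → ℝ) = Icc 0 (y : Fin d → ℝ) :=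
    inter_eq_right.2 (Icc_subset_Icc le_rfl y.2.2)
  rw [boxError, hsub, abs_sub_comm, ← abs_of_pos hN', ← abs_div, abs_of_pos hN', sub_div,
    mul_div_cancel_left₀ _ hN'.ne']
  congr 3
  simp only [indicator]
  rw [Finset.sum_ite, Finset.sum_const_zero, add_zero, Finset.sum_const, nsmul_eq_mul, mul_one]

theorem mainTheorem5 {S : Type*} [MeasurableSpace S] (P : Measure S) [IsProbabilityMeasure P]
    (d b m N : ℕ) (hd : 1 ≤ d) (hb : 1 ≤ b) (hm : 1 ≤ m) (hN : N = b ^ m)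
    (q : ℝ) (hq0 : 0 < q) (hq1 : q < 1)
    (H : ℝ → Fin d → ℝ) (hH : IsHilbertCurve d H)
    (X : Fin N → S → Fin d → ℝ) (hX : IsHSFCSample P H X)
    (f : (Fin d → ℝ) → ℝ) (hf : ContDiffOn ℝ d f (Icc 0 1))
    (K : Set (Fin d → ℝ)) (hKmeas : MeasurableSet K) (hKconv : Convex ℝ K)
    (hKsub : K ⊆ Icc 0 1) :
    ENNReal.ofReal q ≤
      P {s | starDiscrepancy (fun n => X n s) ≤ hsfcBound d N q ∧
        |(∑ n, K.indicator f (X n s)) / N - ∫ x in K, f x| ≤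
          2 ^ d * hsfcBound d N q * cubeVariation f} := by
  have hN0 : 0 < N := hN ▸ Nat.pow_pos hb
  set G := {s | starDiscrepancy (fun n => X n s) ≤ hsfcBound d N q ∧
    |(∑ n, K.indicator f (X n s)) / N - ∫ x in K, f x| ≤
      2 ^ d * hsfcBound d N q * cubeVariation f}
  let bad : Set (Fin d → ℝ) → Set S := fun Ω =>
    {s | ∃ y ∈ Icc (0 : Fin d → ℝ) 1, hsfcBound d N q < |boxError Ω (fun n => X n s) y| / N}
  have h1 : P.real (bad (Icc 0 1)) ≤ (1 - q) / 2 :=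
    hX.measureReal_exists_boxError_le hd hN0 hH measurableSet_Icc (convex_Icc _ _) le_rfl hq0 hq1
  have h2 : P.real (bad K) ≤ (1 - q) / 2 :=
    hX.measureReal_exists_boxError_le hd hN0 hH hKmeas hKconv hKsub hq0 hq1
  -- The two failure sets have total measure at most `1 - q`. Only monotonicity and subadditivity
  -- are used, so measurability of these sets plays no role.
  have hcover : univ ⊆ G ∪ (bad (Icc 0 1) ∪ bad K) := by
    intro s _
    by_contra hs
    simp only [mem_union, not_or] at hs
    obtain ⟨hG, hs1, hs2⟩ := hs
    simp only [bad, mem_ofPred_eq, not_exists, not_and, not_lt] at hs1 hs2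
    exact hG ⟨starDiscrepancy_le_of_boxError hN0 hs1,
      abs_quadrature_sub_integral_le hN0 hf hKmeas hKsub _ hs2⟩
  have h3 : (1 : ℝ) ≤ P.real G + (P.real (bad (Icc 0 1)) + P.real (bad K)) := by
    calc (1 : ℝ) = P.real univ := probReal_univ.symm
      _ ≤ P.real (G ∪ (bad (Icc 0 1) ∪ bad K)) := measureReal_mono hcover
      _ ≤ P.real G + P.real (bad (Icc 0 1) ∪ bad K) := measureReal_union_le _ _
      _ ≤ _ := by gcongr; exact measureReal_union_le _ _
  refine ENNReal.ofReal_le_of_le_toReal ?_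
  rw [← measureReal_def]
  linarith
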